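/- Let $\Gamma=(X,R)$ be a bipartite distance-regular graph with diameter $D\ge 4$, valency $k\ge 3$, path-length distance $\partial$, and intersection numbers $p^h_{ij}=|\{z\in X:\partial(y,z)=i,\ \partial(z,w)=j\}|$ ($\partial(y,w)=h$), $b_i=p^i_{1,i+1}$. Let $A$ be the adjacency matrix of $\Gamma$, let $A_2$ be its second distance matrix (with $(y,z)$ entry $1$ if $\partial(y,z)=2$ and $0$ otherwise), let $\theta_0>\theta_1>\cdots>\theta_D$ be the distinct eigenvalues of $A$, let $M\subseteq \mathrm{Mat}_X(\mathbb C)$ be the algebra generated by $A$, and put $d=\lfloor D/2\rfloor$. Let $V=\mathbb C^X$ with the Hermitian inner product $\langle u,v\rangle=u^t\overline v$. Fix $x\in X$. For $0\le i\le D$ let $E_i^*$ be the diagonal matrix with $(y,y)$ entry $1$ if $\partial(x,y)=i$ and $0$ otherwise, and let $T\subseteq \mathrm{Mat}_X(\mathbb C)$ be the algebra generated by $A,E_0^*,\dots,E_D^*$. A $T$-module is a subspace $W\subseteq V$ with $TW\subseteq W$; it is irreducible if $W\ne0$ and $W$ contains no $T$-modules other than $0$ and $W$. An irreducible $T$-module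 $W$ is thin if $\dim E_i^*W\le 1$ for $0\le i\le D$; its endpoint is $\min\{i: 0\le i\le D,\ E_i^*W\neq 0\}$. A thin irreducible $T$-module $W$ with endpoint $2$ has local eigenvalue $\eta$ if the one-dimensional space $E_2^*W$ consists of vectors $w$ with $E_2^*A_2E_2^*w=\eta w$. Let $V_0$ be the unique irreducible $T$-module with endpoint $0$, let $Y$ be the span of all irreducible $T$-modules with endpoint $1$, and let $U$ be the orthogonal complement of $E_2^*V_0+E_2^*Y$ in $E_2^*V$. For $\eta\in\mathbb R$ let $U_\eta=\{u\in U: E_2^*A_2E_2^*u=\eta u\}$. **Theorem.** Let $n\in\{1,d\}$ if $D$ is odd, and let $n=1$ if $D$ is even. Then $\theta_n^2\neq b_2$, so that $$\eta=\tilde\theta_n=-1-\frac{b_2b_3}{\theta_n^2-b_2}$$ is a well-defined real number, and for every nonzero $v\in U_\eta$ the space $Mv=\{Bv: B\in M\}$ is a thin irreducible $T$-module with endpoint $2$ and local eigenvalue $\eta$. -/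

import Mathlib

noncomputable section

namespace DRG

/-- `Γ` is a distance-regular graph of diameter `D` with intersection numbers
`p h i j` (written $p^h_{ij}$), for `0 ≤ h, i, j ≤ D`.
The values of `p` outside this range carry no meaning. -/
structure IsDistanceRegularWith {X : Type*} [Fintype X]
    (Γ : SimpleGraph X) (D : ℕ) (p : ℕ → ℕ → ℕ → ℕ) : Prop where
  connected : Γ.Connected
  diam_eq : Γ.diam = D
  card_eq : ∀ h i j : ℕ, h ≤ D → i ≤ D → j ≤ D → ∀ x y : X, Γ.dist x y = h →
    (Finset.univ.filter fun z : X => Γ.dist x z = i ∧ Γ.dist z y = j).card = p h i j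

/-- The intersection number $b_i = p^i_{1,i+1}$. -/
def bNum (p : ℕ → ℕ → ℕ → ℕ) (i : ℕ) : ℕ := p i 1 (i + 1)

/-- The `i`-th distance matrix $A_i$. -/
def distMatrix {X : Type*} (Γ : SimpleGraph X) (i : ℕ) : Matrix X X ℂ :=
  Matrix.of fun y z => if Γ.dist y z = i then 1 else 0

/-- The Bose-Mesner algebra `M`: the algebra generated by the adjacency matrix. -/
def boseMesner {X : Type*} [Fintype X] [DecidableEq X] (Γ : SimpleGraph X)
    [DecidableRel Γ.Adj] : Subalgebra ℂ (Matrix X X ℂ) :=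
  Algebra.adjoin ℂ {Γ.adjMatrix ℂ}

/-- The set of real numbers that are eigenvalues of the adjacency matrix is finite. -/
theorem finite_eigenvalues {X : Type*} [Fintype X] [DecidableEq X] (Γ : SimpleGraph X)
    [DecidableRel Γ.Adj] :
    {t : ℝ | Module.End.HasEigenvalue (Matrix.toLin' (Γ.adjMatrix ℂ)) (t : ℂ)}.Finite :=
  (Module.End.finite_hasEigenvalue (Matrix.toLin' (Γ.adjMatrix ℂ))).preimage
    Complex.ofReal_injective.injOn

/-- The distinct eigenvalues of `Γ`, in decreasing order:
`eigenvalue Γ i` is $θ_i$, where $θ_0 > θ_1 > \cdots$ (and 0 past the end of the list).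
All eigenvalues are real, since the adjacency matrix is real symmetric. -/
def eigenvalue {X : Type*} [Fintype X] [DecidableEq X] (Γ : SimpleGraph X)
    [DecidableRel Γ.Adj] (i : ℕ) : ℝ :=
  ((finite_eigenvalues Γ).toFinset.sort (fun a b => b ≤ a)).getD i 0

/-- The dual idempotent $E_i^* = E_i^*(x)$. -/
def dualIdem {X : Type*} [DecidableEq X] (Γ : SimpleGraph X) (x : X) (i : ℕ) :
    Matrix X X ℂ :=
  Matrix.diagonal fun y => if Γ.dist x y = i then 1 else 0

/-- The dual Bose-Mesner algebra $M^* = M^*(x)$. -/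
def dualBoseMesner {X : Type*} [Fintype X] [DecidableEq X] (Γ : SimpleGraph X) (x : X) :
    Subalgebra ℂ (Matrix X X ℂ) :=
  Algebra.adjoin ℂ (Set.range (dualIdem Γ x))

/-- The subconstituent (Terwilliger) algebra `T = T(x)`, generated by $M$ and $M^*$. -/
def terwilliger {X : Type*} [Fintype X] [DecidableEq X] (Γ : SimpleGraph X)
    [DecidableRel Γ.Adj] (x : X) : Subalgebra ℂ (Matrix X X ℂ) :=
  boseMesner Γ ⊔ dualBoseMesner Γ x

/-- A `T`-module: a subspace of the standard module `ℂ^X` invariant under `T`. -/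
def IsTModule {X : Type*} [Fintype X] [DecidableEq X] (Γ : SimpleGraph X)
    [DecidableRel Γ.Adj] (x : X) (W : Submodule ℂ (X → ℂ)) : Prop :=
  ∀ B ∈ terwilliger Γ x, ∀ w ∈ W, B.mulVec w ∈ W

/-- An irreducible `T`-module. -/
def IsIrreducibleTModule {X : Type*} [Fintype X] [DecidableEq X] (Γ : SimpleGraph X)
    [DecidableRel Γ.Adj] (x : X) (W : Submodule ℂ (X → ℂ)) : Prop :=
  IsTModule Γ x W ∧ W ≠ ⊥ ∧
    ∀ W' : Submodule ℂ (X → ℂ), W' ≤ W → IsTModule Γ x W' → W' = ⊥ ∨ W' = W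

/-- The subspace $E_i^* W$. -/
def dualPart {X : Type*} [Fintype X] [DecidableEq X] (Γ : SimpleGraph X) (x : X) (i : ℕ)
    (W : Submodule ℂ (X → ℂ)) : Submodule ℂ (X → ℂ) :=
  W.map (Matrix.mulVecLin (dualIdem Γ x i))

/-- `W` has endpoint `r`: `r` is the minimum of the `i`, `0 ≤ i ≤ D`, with $E_i^* W ≠ 0$. -/
def HasEndpoint {X : Type*} [Fintype X] [DecidableEq X] (Γ : SimpleGraph X) (x : X)
    (W : Submodule ℂ (X → ℂ)) (r : ℕ) : Prop :=
  IsLeast {i : ℕ | i ≤ Γ.diam ∧ dualPart Γ x i W ≠ ⊥} r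

/-- `W` is thin: $\dim E_i^* W ≤ 1$ for `0 ≤ i ≤ D`. -/
def IsThin {X : Type*} [Fintype X] [DecidableEq X] (Γ : SimpleGraph X) (x : X)
    (W : Submodule ℂ (X → ℂ)) : Prop :=
  ∀ i ≤ Γ.diam, Module.finrank ℂ (dualPart Γ x i W) ≤ 1

/-- The matrix $E_2^* A_2 E_2^*$. -/
def localMatrix {X : Type*} [Fintype X] [DecidableEq X] (Γ : SimpleGraph X) (x : X) :
    Matrix X X ℂ :=
  dualIdem Γ x 2 * distMatrix Γ 2 * dualIdem Γ x 2

/-- `W` has local eigenvalue `η`: $E_2^* W$ is one-dimensional and consists of eigenvectors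
of $E_2^* A_2 E_2^*$ for `η` (and the zero vector). -/
def HasLocalEigenvalue {X : Type*} [Fintype X] [DecidableEq X] (Γ : SimpleGraph X) (x : X)
    (W : Submodule ℂ (X → ℂ)) (η : ℝ) : Prop :=
  Module.finrank ℂ (dualPart Γ x 2 W) = 1 ∧
    ∀ w ∈ dualPart Γ x 2 W, (localMatrix Γ x).mulVec w = (η : ℂ) • w

/-- The span of all irreducible `T`-modules with endpoint `r`. For `r = 0` this is the unique
irreducible `T`-module $V_0$ with endpoint 0, for `r = 1` it is the space $Y$. -/
def endpointSpan {X : Type*} [Fintype X] [DecidableEq X] (Γ : SimpleGraph X)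
    [DecidableRel Γ.Adj] (x : X) (r : ℕ) : Submodule ℂ (X → ℂ) :=
  sSup {W | IsIrreducibleTModule Γ x W ∧ HasEndpoint Γ x W r}

/-- The space `U`: the orthogonal complement of $E_2^* V_0 + E_2^* Y$ in $E_2^* V$, with respect
to the Hermitian form $\langle w, u\rangle = w^t \overline{u}$. -/
def spaceU {X : Type*} [Fintype X] [DecidableEq X] (Γ : SimpleGraph X)
    [DecidableRel Γ.Adj] (x : X) : Submodule ℂ (X → ℂ) where
  carrier := {u | u ∈ dualPart Γ x 2 ⊤ ∧
    ∀ w ∈ dualPart Γ x 2 (endpointSpan Γ x 0) ⊔ dualPart Γ x 2 (endpointSpan Γ x 1),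
      w ⬝ᵥ star u = 0}
  add_mem' := by
    rintro a b ⟨ha, ha'⟩ ⟨hb, hb'⟩
    refine ⟨Submodule.add_mem _ ha hb, fun w hw => ?_⟩
    rw [star_add, dotProduct_add, ha' w hw, hb' w hw, add_zero]
  zero_mem' := ⟨Submodule.zero_mem _, fun w _ => by simp⟩
  smul_mem' := by
    rintro c a ⟨ha, ha'⟩
    refine ⟨Submodule.smul_mem _ c ha, fun w hw => ?_⟩
    rw [star_smul, dotProduct_smul, ha' w hw, smul_zero]

/-- The space $U_η$: the vectors `u` in `U` with $E_2^* A_2 E_2^* u = η u$. -/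
def spaceUEta {X : Type*} [Fintype X] [DecidableEq X] (Γ : SimpleGraph X)
    [DecidableRel Γ.Adj] (x : X) (η : ℝ) : Submodule ℂ (X → ℂ) :=
  spaceU Γ x ⊓ Module.End.eigenspace (Matrix.toLin' (localMatrix Γ x)) (η : ℂ)

/-- The space `Mv = {Bv | B ∈ M}`. -/
def boseMesnerOrbit {X : Type*} [Fintype X] [DecidableEq X] (Γ : SimpleGraph X)
    [DecidableRel Γ.Adj] (v : X → ℂ) : Submodule ℂ (X → ℂ) where
  carrier := {w | ∃ B ∈ boseMesner Γ, B.mulVec v = w}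
  add_mem' := by
    rintro _ _ ⟨B, hB, rfl⟩ ⟨C, hC, rfl⟩
    exact ⟨B + C, add_mem hB hC, Matrix.add_mulVec B C v⟩
  zero_mem' := ⟨0, zero_mem _, Matrix.zero_mulVec v⟩
  smul_mem' := by
    rintro c _ ⟨B, hB, rfl⟩
    exact ⟨c • B, Subalgebra.smul_mem _ hB c, Matrix.smul_mulVec c B v⟩

/-- The scalar $\tilde z = -1 - b_2 b_3 (z^2 - b_2)^{-1}$ for real `z` with `z ^ 2 ≠ b₂`. -/
def tilde (p : ℕ → ℕ → ℕ → ℕ) (z : ℝ) : ℝ :=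
  -1 - (bNum p 2 : ℝ) * (bNum p 3 : ℝ) / (z ^ 2 - (bNum p 2 : ℝ))

end DRG

end

/-!
Write `θ = θₙ` and let `e h` be the value at distance `h` of the primitive idempotent `E_θ`, a
polynomial in `A` and hence a function of the distance. For `v ∈ U_η` one has
`⟨E_θ v, E_θ v⟩ = ⟨E_θ v, v⟩ = (e 0 + η e 2 - (1 + η) e 4) ‖v‖²`, and `η = θ̃` is precisely the
value for which the three-term recurrence of `e` makes this factor zero; so `E_θ v = 0`. Since `v`
is orthogonal to `E₂* V₀` and to `E₂* Y`, its entries sum to zero as well. These two facts are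
linear relations between the three vectors `E_{m+2}* A_h v`, `h = m, m+2, m+4`, which span
`E_{m+2}* M v`; they are independent because `θ ≠ 0` and `θ² ≠ k²` prevent
`e m = e (m+2) = e (m+4)`. Hence every `E_i* M v` has dimension at most one.

In a bipartite graph `A` maps each `E_i* V` into `E_{i-1}* V + E_{i+1}* V`, so with one-dimensional
components `M v` is spanned by successive raisings of `v` and is therefore a `T`-module; it is
irreducible because `E₂* M v = ℂ v`.

That `θ₁² > b₂`, and `θ_d² < b₂` for odd `D`, follows from
`tr ((A² - b₂) (k² - A²)) = 0`: the summands have both signs.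
-/

noncomputable section

namespace DRG

open scoped Matrix
open Polynomial

variable {X : Type*} {Γ : SimpleGraph X} {D k : ℕ} {p : ℕ → ℕ → ℕ → ℕ}

/-! ### Distances -/

theorem exists_adj_dist_eq {y z : X} {h : ℕ} (hyz : Γ.dist y z = h + 1) :
    ∃ w, Γ.Adj y w ∧ Γ.dist w z = h := by
  have hreach : Γ.Reachable y z := SimpleGraph.Reachable.of_dist_ne_zero (by omega)
  obtain ⟨q, hq⟩ := hreach.exists_walk_length_eq_dist
  cases q with
  | nil => simp at hyz
  | @cons _ w _ hyw q =>
    refine ⟨w, hyw, ?_⟩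
    have hle : Γ.dist w z ≤ q.length := SimpleGraph.dist_le q
    have htri := hyw.reachable.dist_triangle_left z
    rw [SimpleGraph.dist_eq_one_iff_adj.mpr hyw] at htri
    rw [SimpleGraph.Walk.length_cons] at hq
    omega

theorem exists_dist_eq_of_le_diam [Nonempty X] {h : ℕ} (hh : h ≤ Γ.diam) :
    ∃ y z : X, Γ.dist y z = h := by
  induction hh using Nat.decreasingInduction with
  | self => exact Γ.exists_dist_eq_diam
  | of_succ h _ ih =>
    obtain ⟨y, z, hyz⟩ := ih
    obtain ⟨w, -, hwz⟩ := exists_adj_dist_eq hyz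
    exact ⟨w, z, hwz⟩

theorem even_dist_add (hc : Γ.Connected) (hbip : Γ.IsBipartite) (x y z : X) :
    Even (Γ.dist x y + Γ.dist y z + Γ.dist x z) := by
  obtain ⟨C⟩ : Nonempty (Γ.Coloring Bool) := ⟨(hbip : Γ.Colorable 2).toColoring (by simp)⟩
  have even_dist_iff (u v : X) : Even (Γ.dist u v) ↔ (C u ↔ C v) := by
    obtain ⟨q, hq⟩ := hc.exists_walk_length_eq_dist u v
    rw [← hq]
    exact C.even_length_iff_congr q
  rw [Nat.even_add, Nat.even_add, even_dist_iff, even_dist_iff, even_dist_iff]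
  tauto

theorem dist_of_adj (hc : Γ.Connected) (hbip : Γ.IsBipartite) {y w : X} (hyw : Γ.Adj y w) (z : X) :
    Γ.dist w z + 1 = Γ.dist y z ∨ Γ.dist w z = Γ.dist y z + 1 := by
  have hone := SimpleGraph.dist_eq_one_iff_adj.mpr hyw
  have heven := Nat.even_iff.mp (even_dist_add hc hbip y w z)
  have hdiff := hyw.diff_dist_adj (u := z)
  simp only [Γ.dist_comm (u := z)] at hdiff
  omega

/-! ### Intersection numbers -/

/-- The intersection number $c_i = p^i_{1,i-1}$. Truncated subtraction makes `cNum p 0` equal to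
$p^0_{10} = 0$, which is the usual convention for $c_0$. -/
def cNum (p : ℕ → ℕ → ℕ → ℕ) (i : ℕ) : ℕ := p i 1 (i - 1)

namespace IsDistanceRegularWith

variable [Fintype X]

theorem dist_le (hΓ : IsDistanceRegularWith Γ D p) (y z : X) : Γ.dist y z ≤ D := by
  have := hΓ.connected.nonempty
  rw [← hΓ.diam_eq]
  exact SimpleGraph.dist_le_diam (SimpleGraph.connected_iff_ediam_ne_top.mp hΓ.connected)

theorem exists_dist_eq (hΓ : IsDistanceRegularWith Γ D p) {h : ℕ} (hh : h ≤ D) :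
    ∃ y z : X, Γ.dist y z = h := by
  have := hΓ.connected.nonempty
  exact exists_dist_eq_of_le_diam (hΓ.diam_eq ▸ hh)

theorem card_neighborFinset_filter [DecidableRel Γ.Adj] (hΓ : IsDistanceRegularWith Γ D p)
    (hD : 1 ≤ D) {j : ℕ} (hj : j ≤ D) {y z : X} {h : ℕ} (hyz : Γ.dist y z = h) :
    ((Γ.neighborFinset y).filter fun w => Γ.dist w z = j).card = p h 1 j := by
  rw [← hΓ.card_eq h 1 j (hyz ▸ hΓ.dist_le y z) hD hj y z hyz]
  congr 1
  ext w
  simp only [Finset.mem_filter, SimpleGraph.mem_neighborFinset, Finset.mem_univ, true_and,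
    SimpleGraph.dist_eq_one_iff_adj]

theorem cNum_zero (hΓ : IsDistanceRegularWith Γ D p) (hD : 1 ≤ D) : cNum p 0 = 0 := by
  classical
  obtain ⟨y, z, hyz⟩ := hΓ.exists_dist_eq D.zero_le
  obtain rfl := hΓ.connected.dist_eq_zero_iff.mp hyz
  rw [cNum, ← hΓ.card_neighborFinset_filter hD (by omega) hyz, Finset.card_eq_zero,
    Finset.filter_eq_empty_iff]
  intro w hw
  have := SimpleGraph.dist_eq_one_iff_adj.mpr ((Γ.mem_neighborFinset y w).mp hw).symm
  omega

theorem cNum_one (hΓ : IsDistanceRegularWith Γ D p) (hD : 1 ≤ D) : cNum p 1 = 1 := by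
  classical
  obtain ⟨y, z, hyz⟩ := hΓ.exists_dist_eq hD
  rw [cNum, ← hΓ.card_neighborFinset_filter hD (by omega) hyz, Finset.card_eq_one]
  refine ⟨z, Finset.ext fun w => ?_⟩
  simp only [Nat.sub_self, Finset.mem_filter, SimpleGraph.mem_neighborFinset,
    Finset.mem_singleton, hΓ.connected.dist_eq_zero_iff, and_iff_right_iff_imp]
  rintro rfl
  exact SimpleGraph.dist_eq_one_iff_adj.mp hyz

theorem cNum_pos (hΓ : IsDistanceRegularWith Γ D p) {h : ℕ} (hh : h + 1 ≤ D) :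
    0 < cNum p (h + 1) := by
  classical
  obtain ⟨y, z, hyz⟩ := hΓ.exists_dist_eq hh
  obtain ⟨w, hyw, hwz⟩ := exists_adj_dist_eq hyz
  rw [cNum, ← hΓ.card_neighborFinset_filter (by omega) (by omega) hyz, Finset.card_pos]
  exact ⟨w, Finset.mem_filter.mpr ⟨(Γ.mem_neighborFinset y w).mpr hyw, by omega⟩⟩

theorem bNum_pos (hΓ : IsDistanceRegularWith Γ D p) {h : ℕ} (hh : h < D) : 0 < bNum p h := by
  classical
  obtain ⟨y, z, hyz⟩ := hΓ.exists_dist_eq hh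
  obtain ⟨w, hyw, hwz⟩ := exists_adj_dist_eq hyz
  rw [bNum, ← hΓ.card_neighborFinset_filter (by omega) (by omega) hwz, Finset.card_pos]
  exact ⟨y, Finset.mem_filter.mpr ⟨(Γ.mem_neighborFinset w y).mpr hyw.symm, by omega⟩⟩

variable [DecidableRel Γ.Adj]

theorem sum_neighborFinset_dist (hΓ : IsDistanceRegularWith Γ D p) (hbip : Γ.IsBipartite)
    {R : Type*} [Semiring R] (u : ℕ → R) {y z : X} {h : ℕ} (hyz : Γ.dist y z = h) (hh : h < D) :
    ∑ w ∈ Γ.neighborFinset y, u (Γ.dist w z) = cNum p h * u (h - 1) + bNum p h * u (h + 1) := by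
  have hnot : (Γ.neighborFinset y).filter (fun w => ¬Γ.dist w z = h - 1) =
      (Γ.neighborFinset y).filter fun w => Γ.dist w z = h + 1 := by
    refine Finset.filter_congr fun w hw => ?_
    have := dist_of_adj hΓ.connected hbip ((Γ.mem_neighborFinset y w).mp hw) z
    omega
  rw [← Finset.sum_filter_add_sum_filter_not _ (fun w => Γ.dist w z = h - 1), hnot, cNum, bNum,
    ← hΓ.card_neighborFinset_filter (by omega) (by omega) hyz,
    ← hΓ.card_neighborFinset_filter (by omega) (by omega) hyz, ← nsmul_eq_mul, ← nsmul_eq_mul]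
  congr 1 <;> refine Finset.sum_eq_card_nsmul fun w hw => ?_ <;> rw [(Finset.mem_filter.mp hw).2]

theorem cNum_add_bNum (hΓ : IsDistanceRegularWith Γ D p) (hbip : Γ.IsBipartite)
    (hreg : Γ.IsRegularOfDegree k) {h : ℕ} (hh : h < D) : cNum p h + bNum p h = k := by
  obtain ⟨y, z, hyz⟩ := hΓ.exists_dist_eq hh.le
  have hsum := hΓ.sum_neighborFinset_dist hbip (fun _ => (1 : ℕ)) hyz hh
  rw [Finset.sum_const, Γ.card_neighborFinset_eq_degree, hreg.degree_eq] at hsum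
  simpa using hsum.symm

end IsDistanceRegularWith

/-! ### The Bose–Mesner algebra -/

/-- The matrix whose entries are a prescribed function `u` of the distance, that is
$\sum_i u_i A_i$. -/
def ofDist (Γ : SimpleGraph X) : (ℕ → ℂ) →ₗ[ℂ] Matrix X X ℂ where
  toFun u := Matrix.of fun y z => u (Γ.dist y z)
  map_add' _ _ := rfl
  map_smul' _ _ := rfl

theorem ofDist_apply (u : ℕ → ℂ) (y z : X) : ofDist Γ u y z = u (Γ.dist y z) := rfl

theorem adjMatrix_eq_ofDist [DecidableRel Γ.Adj] :
    Γ.adjMatrix ℂ = ofDist Γ (Pi.single 1 1) := by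
  ext y z
  simp [ofDist_apply, Pi.single_apply, SimpleGraph.adjMatrix_apply]

namespace IsDistanceRegularWith

variable [Fintype X]

theorem ofDist_mul_ofDist (hΓ : IsDistanceRegularWith Γ D p) (u v : ℕ → ℂ) :
    ofDist Γ u * ofDist Γ v = ofDist Γ fun h =>
      ∑ i ∈ Finset.range (D + 1), ∑ j ∈ Finset.range (D + 1), p h i j * (u i * v j) := by
  ext y z
  have hmaps : ∀ w ∈ (Finset.univ : Finset X), (Γ.dist y w, Γ.dist w z) ∈
      Finset.range (D + 1) ×ˢ Finset.range (D + 1) := fun w _ =>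
    Finset.mem_product.mpr ⟨Finset.mem_range_succ_iff.mpr (hΓ.dist_le y w),
      Finset.mem_range_succ_iff.mpr (hΓ.dist_le w z)⟩
  rw [Matrix.mul_apply, ofDist_apply, ← Finset.sum_product',
    ← Finset.sum_fiberwise_of_maps_to hmaps]
  refine Finset.sum_congr rfl fun ⟨i, j⟩ hij => ?_
  rw [Finset.mem_product, Finset.mem_range_succ_iff, Finset.mem_range_succ_iff] at hij
  rw [← hΓ.card_eq _ i j (hΓ.dist_le y z) hij.1 hij.2 y z rfl, ← nsmul_eq_mul]
  simp only [Prod.mk.injEq]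
  refine Finset.sum_eq_card_nsmul fun w hw => ?_
  obtain ⟨-, rfl, rfl⟩ := Finset.mem_filter.mp hw
  rfl

theorem ofDist_eq_sum (hΓ : IsDistanceRegularWith Γ D p) (u : ℕ → ℂ) :
    ofDist Γ u = ∑ i : Fin (D + 1), u i • distMatrix Γ i := by
  ext y z
  rw [← Finset.sum_range fun i => u i • distMatrix Γ i]
  simp [ofDist_apply, Matrix.sum_apply, distMatrix, hΓ.dist_le y z]

theorem distMatrix_eq_zero_of_lt (hΓ : IsDistanceRegularWith Γ D p) {i : ℕ} (hi : D < i) :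
    distMatrix Γ i = 0 := by
  ext y z
  exact if_neg ((hΓ.dist_le y z).trans_lt hi).ne

variable [DecidableRel Γ.Adj]

theorem adjMatrix_mul_ofDist_apply (hΓ : IsDistanceRegularWith Γ D p) (hbip : Γ.IsBipartite)
    (u : ℕ → ℂ) {y z : X} {h : ℕ} (hyz : Γ.dist y z = h) (hh : h < D) :
    (Γ.adjMatrix ℂ * ofDist Γ u) y z = cNum p h * u (h - 1) + bNum p h * u (h + 1) := by
  rw [SimpleGraph.adjMatrix_mul_apply]
  exact hΓ.sum_neighborFinset_dist hbip u hyz hh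

variable [DecidableEq X]

theorem exists_eq_ofDist_of_mem_boseMesner (hΓ : IsDistanceRegularWith Γ D p)
    {B : Matrix X X ℂ} (hB : B ∈ boseMesner Γ) : ∃ u : ℕ → ℂ, B = ofDist Γ u := by
  have hone : (1 : Matrix X X ℂ) = ofDist Γ (Pi.single 0 1) := by
    ext y z
    simp [ofDist_apply, Matrix.one_apply, Pi.single_apply, hΓ.connected.dist_eq_zero_iff]
  induction hB using Algebra.adjoin_induction with
  | mem B hB => exact ⟨_, (Set.mem_singleton_iff.mp hB).trans adjMatrix_eq_ofDist⟩
  | algebraMap c => exact ⟨_, by rw [Algebra.algebraMap_eq_smul_one, hone, ← map_smul]⟩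
  | add B C _ _ ihB ihC =>
    obtain ⟨⟨u, rfl⟩, ⟨v, rfl⟩⟩ := And.intro ihB ihC
    exact ⟨u + v, (map_add _ u v).symm⟩
  | mul B C _ _ ihB ihC =>
    obtain ⟨⟨u, rfl⟩, ⟨v, rfl⟩⟩ := And.intro ihB ihC
    exact ⟨_, hΓ.ofDist_mul_ofDist u v⟩

theorem finrank_boseMesner_le (hΓ : IsDistanceRegularWith Γ D p) :
    Module.finrank ℂ (boseMesner Γ) ≤ D + 1 := by
  have hle : Subalgebra.toSubmodule (boseMesner Γ) ≤
      Submodule.span ℂ (Set.range fun i : Fin (D + 1) => distMatrix Γ i) := by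
    intro B hB
    obtain ⟨u, rfl⟩ := hΓ.exists_eq_ofDist_of_mem_boseMesner hB
    rw [hΓ.ofDist_eq_sum]
    exact Submodule.sum_smul_mem _ _ fun i _ => Submodule.subset_span ⟨i, rfl⟩
  exact (Submodule.finrank_mono hle).trans
    ((finrank_range_le_card _).trans (Fintype.card_fin _).le)

end IsDistanceRegularWith

/-! ### Polynomials in a Hermitian matrix -/

section Hermitian

variable {ι 𝕜 : Type*} [RCLike 𝕜] [Fintype ι] [DecidableEq ι] {H : Matrix ι ι 𝕜}

theorem aeval_eq_zero_of_forall_spectrum (hH : H.IsHermitian) {q : ℝ[X]}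
    (hq : ∀ t ∈ spectrum ℝ H, q.eval t = 0) : aeval H q = 0 := by
  rw [← cfc_polynomial q H hH.isSelfAdjoint, cfc_congr (g := fun _ => 0) hq, cfc_const_zero]

theorem isHermitian_aeval (hH : H.IsHermitian) (q : ℝ[X]) : (aeval H q).IsHermitian := by
  rw [← cfc_polynomial q H hH.isSelfAdjoint]
  exact cfc_predicate _ H

open scoped MatrixOrder ComplexOrder in
theorem exists_eval_pos_of_trace_eq_zero (hH : H.IsHermitian) {q : ℝ[X]}
    (htr : (aeval H q).trace = 0) (hne : aeval H q ≠ 0) : ∃ t ∈ spectrum ℝ H, 0 < q.eval t := by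
  by_contra! hle
  have hpsd : (aeval H (-q)).PosSemidef := by
    rw [← Matrix.nonneg_iff_posSemidef, ← cfc_polynomial (-q) H hH.isSelfAdjoint]
    exact cfc_nonneg fun t ht => by simpa using hle t ht
  rw [map_neg] at hpsd
  exact hne (neg_eq_zero.mp (hpsd.trace_eq_zero_iff.mp (by rw [Matrix.trace_neg, htr, neg_zero])))

theorem exists_eval_neg_of_trace_eq_zero (hH : H.IsHermitian) {q : ℝ[X]}
    (htr : (aeval H q).trace = 0) (hne : aeval H q ≠ 0) : ∃ t ∈ spectrum ℝ H, q.eval t < 0 := by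
  obtain ⟨t, ht, hpos⟩ := exists_eval_pos_of_trace_eq_zero hH (q := -q)
    (by rw [map_neg, Matrix.trace_neg, htr, neg_zero]) (by rwa [map_neg, neg_ne_zero])
  exact ⟨t, ht, by simpa using hpos⟩

end Hermitian

/-! ### The spectrum of the adjacency matrix -/

section Spectrum

variable [Fintype X] [DecidableEq X] [DecidableRel Γ.Adj]

/-- The finite set of real eigenvalues of `Γ`, which `eigenvalue Γ` lists in decreasing order. -/
def eigenvalueFinset (Γ : SimpleGraph X) [DecidableRel Γ.Adj] : Finset ℝ :=
  (finite_eigenvalues Γ).toFinset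

theorem mem_eigenvalueFinset_iff_hasEigenvalue {t : ℝ} :
    t ∈ eigenvalueFinset Γ ↔ Module.End.HasEigenvalue (Matrix.toLin' (Γ.adjMatrix ℂ)) (t : ℂ) := by
  rw [eigenvalueFinset, Set.Finite.mem_toFinset, Set.mem_ofPred_eq]

theorem mem_eigenvalueFinset_iff {t : ℝ} :
    t ∈ eigenvalueFinset Γ ↔ t ∈ spectrum ℝ (Γ.adjMatrix ℂ) := by
  rw [mem_eigenvalueFinset_iff_hasEigenvalue, Module.End.hasEigenvalue_iff_mem_spectrum,
    Matrix.spectrum_toLin', ← spectrum.algebraMap_mem_iff ℂ (R := ℝ)]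
  rfl

theorem aeval_adjMatrix_eq_zero {q : ℝ[X]} (hq : ∀ t ∈ eigenvalueFinset Γ, q.eval t = 0) :
    aeval (Γ.adjMatrix ℂ) q = 0 :=
  aeval_eq_zero_of_forall_spectrum (Γ.isHermitian_adjMatrix ℂ) fun t ht =>
    hq t (mem_eigenvalueFinset_iff.mpr ht)

theorem neg_mem_eigenvalueFinset (hbip : Γ.IsBipartite) {t : ℝ} (ht : t ∈ eigenvalueFinset Γ) :
    -t ∈ eigenvalueFinset Γ := by
  obtain ⟨C⟩ : Nonempty (Γ.Coloring Bool) := ⟨(hbip : Γ.Colorable 2).toColoring (by simp)⟩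
  let σ : Matrix X X ℂ := Matrix.diagonal fun y => if C y then 1 else -1
  have hσ : σ * σ = 1 := by
    rw [Matrix.diagonal_mul_diagonal, ← Matrix.diagonal_one]
    congr 1
    ext y
    split_ifs <;> norm_num
  have hconj : σ * Γ.adjMatrix ℂ * σ = -Γ.adjMatrix ℂ := by
    ext y z
    rw [Matrix.mul_diagonal, Matrix.diagonal_mul, Matrix.neg_apply, SimpleGraph.adjMatrix_apply]
    by_cases hyz : Γ.Adj y z
    · have := C.valid hyz
      cases hy : C y <;> cases hz : C z <;> simp_all
    · simp [hyz]
  rw [mem_eigenvalueFinset_iff] at ht ⊢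
  rw [← Set.mem_neg, spectrum.neg_eq, ← hconj]
  exact (spectrum.units_conjugate (R := ℝ) (u := ⟨σ, σ, hσ, hσ⟩)).symm ▸ ht

theorem degree_mem_eigenvalueFinset [Nonempty X] (hreg : Γ.IsRegularOfDegree k) :
    (k : ℝ) ∈ eigenvalueFinset Γ := by
  rw [mem_eigenvalueFinset_iff_hasEigenvalue]
  refine Module.End.hasEigenvalue_of_hasEigenvector (x := Function.const X 1)
    ⟨Module.End.mem_eigenspace_iff.mpr (funext fun y => ?_), Function.const_ne_zero.mpr one_ne_zero⟩
  rw [Matrix.toLin'_apply, SimpleGraph.adjMatrix_mulVec_const_apply_of_regular hreg]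
  simp

theorem abs_le_degree_of_mem_eigenvalueFinset (hreg : Γ.IsRegularOfDegree k) {t : ℝ}
    (ht : t ∈ eigenvalueFinset Γ) : |t| ≤ k := by
  obtain ⟨y, hy⟩ := eigenvalue_mem_ball (mem_eigenvalueFinset_iff_hasEigenvalue.mp ht)
  have hrow : ∑ z ∈ Finset.univ.erase y, ‖Γ.adjMatrix ℂ y z‖ ≤ ∑ z, ‖Γ.adjMatrix ℂ y z‖ :=
    Finset.sum_le_sum_of_subset_of_nonneg (Finset.erase_subset _ _) fun _ _ _ => norm_nonneg _
  have hdeg : ∑ z, ‖Γ.adjMatrix ℂ y z‖ = k := by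
    simp [SimpleGraph.adjMatrix_apply, apply_ite, ← hreg.degree_eq y,
      ← SimpleGraph.card_neighborFinset_eq_degree, SimpleGraph.neighborFinset_eq_filter]
  rw [Metric.mem_closedBall, SimpleGraph.adjMatrix_apply, if_neg (Γ.irrefl), dist_zero_right,
    Complex.norm_real, Real.norm_eq_abs] at hy
  exact hy.trans (hrow.trans hdeg.le)

/-! ### The number of eigenvalues -/

/- The `(y, z)` entry of `A ^ i` counts the walks of length `i`, hence vanishes for `i < ∂(y, z)`
but not for `i = ∂(y, z)`. -/
theorem diam_lt_natDegree_of_aeval_adjMatrix_eq_zero (hc : Γ.Connected) {q : ℝ[X]} (hq : q ≠ 0)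
    (haeval : aeval (Γ.adjMatrix ℂ) q = 0) : Γ.diam < q.natDegree := by
  by_contra! hle
  have := hc.nonempty
  obtain ⟨y, z, hyz⟩ := exists_dist_eq_of_le_diam hle
  have hpow_lt : ∀ i ∈ Finset.range q.natDegree, q.coeff i • (Γ.adjMatrix ℂ ^ i) y z = 0 := by
    intro i hi
    have : IsEmpty {w : Γ.Walk y z | w.length = i} := ⟨fun ⟨w, hw⟩ =>
      (Finset.mem_range.mp hi).not_ge (hyz ▸ hw ▸ SimpleGraph.dist_le w)⟩
    rw [SimpleGraph.adjMatrix_pow_apply_eq_card_walk, Fintype.card_eq_zero, Nat.cast_zero,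
      smul_zero]
  have hpow_eq : (Γ.adjMatrix ℂ ^ q.natDegree) y z ≠ 0 := by
    obtain ⟨w, hw⟩ := hc.exists_walk_length_eq_dist y z
    rw [SimpleGraph.adjMatrix_pow_apply_eq_card_walk, Nat.cast_ne_zero]
    exact (Fintype.card_pos_iff.mpr ⟨⟨w, hw.trans hyz⟩⟩).ne'
  have hentry := congrFun₂ haeval y z
  simp only [aeval_eq_sum_range, Matrix.sum_apply, Matrix.smul_apply, Matrix.zero_apply] at hentry
  rw [Finset.sum_range_succ, Finset.sum_eq_zero hpow_lt, zero_add] at hentry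
  exact smul_ne_zero (leadingCoeff_ne_zero.mpr hq) hpow_eq hentry

theorem diam_lt_card_eigenvalueFinset (hc : Γ.Connected) :
    Γ.diam < (eigenvalueFinset Γ).card := by
  rw [← natDegree_finsetProd_X_sub_C_eq_card (eigenvalueFinset Γ) id]
  refine diam_lt_natDegree_of_aeval_adjMatrix_eq_zero hc
    (monic_prod_of_monic _ _ fun t _ => monic_X_sub_C t).ne_zero
    (aeval_adjMatrix_eq_zero fun t ht => ?_)
  rw [eval_prod]
  exact Finset.prod_eq_zero ht (by simp)

theorem card_eigenvalueFinset_le_finrank_boseMesner :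
    (eigenvalueFinset Γ).card ≤ Module.finrank ℂ (boseMesner Γ) := by
  let A : boseMesner Γ := ⟨Γ.adjMatrix ℂ, Algebra.self_mem_adjoin_singleton ℂ _⟩
  have hminpoly : minpoly ℂ A = minpoly ℂ (Matrix.toLin' (Γ.adjMatrix ℂ)) := by
    rw [Matrix.minpoly_toLin', ← minpoly.algHom_eq (boseMesner Γ).val Subtype.val_injective]
    rfl
  rw [← Finset.card_map ⟨_, Complex.ofReal_injective⟩]
  refine (card_le_degree_of_subset_roots (p := minpoly ℂ A) fun s hs => ?_).trans
    (minpoly.natDegree_le A)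
  obtain ⟨t, ht, rfl⟩ := Finset.mem_map.mp hs
  rw [mem_roots (minpoly.ne_zero_of_finite ℂ A), hminpoly]
  exact Module.End.isRoot_of_hasEigenvalue (mem_eigenvalueFinset_iff_hasEigenvalue.mp ht)

theorem IsDistanceRegularWith.card_eigenvalueFinset (hΓ : IsDistanceRegularWith Γ D p) :
    (eigenvalueFinset Γ).card = D + 1 := by
  refine le_antisymm
    (card_eigenvalueFinset_le_finrank_boseMesner.trans hΓ.finrank_boseMesner_le) ?_
  rw [← hΓ.diam_eq]
  exact diam_lt_card_eigenvalueFinset hΓ.connected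

/-! ### The ordering of the eigenvalues -/

theorem eigenvalue_eq_getElem {i : ℕ} (hi : i < (eigenvalueFinset Γ).card) :
    eigenvalue Γ i =
      ((eigenvalueFinset Γ).sort fun a b => b ≤ a)[i]'(by rwa [Finset.length_sort]) :=
  List.getD_eq_getElem _ _ _

theorem eigenvalue_mem {i : ℕ} (hi : i < (eigenvalueFinset Γ).card) :
    eigenvalue Γ i ∈ eigenvalueFinset Γ := by
  rw [eigenvalue_eq_getElem hi, ← Finset.mem_sort fun a b : ℝ => b ≤ a]
  exact List.getElem_mem _

theorem exists_eigenvalue_eq {t : ℝ} (ht : t ∈ eigenvalueFinset Γ) :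
    ∃ i < (eigenvalueFinset Γ).card, eigenvalue Γ i = t := by
  rw [← Finset.mem_sort fun a b : ℝ => b ≤ a] at ht
  obtain ⟨i, hi, hit⟩ := List.getElem_of_mem ht
  rw [Finset.length_sort] at hi
  exact ⟨i, hi, by rw [eigenvalue_eq_getElem hi, hit]⟩

theorem eigenvalue_lt_eigenvalue {i j : ℕ} (hij : i < j) (hj : j < (eigenvalueFinset Γ).card) :
    eigenvalue Γ j < eigenvalue Γ i := by
  rw [eigenvalue_eq_getElem hj, eigenvalue_eq_getElem (hij.trans hj)]
  exact (Finset.sortedGT_sort _).getElem_gt_getElem_of_lt hij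

theorem eigenvalue_le_eigenvalue {i j : ℕ} (hij : i ≤ j) (hj : j < (eigenvalueFinset Γ).card) :
    eigenvalue Γ j ≤ eigenvalue Γ i := by
  rcases hij.eq_or_lt with rfl | hlt
  · exact le_rfl
  · exact (eigenvalue_lt_eigenvalue hlt hj).le

theorem eigenvalue_zero [Nonempty X] (hreg : Γ.IsRegularOfDegree k) : eigenvalue Γ 0 = k := by
  obtain ⟨i, hi, hik⟩ := exists_eigenvalue_eq (degree_mem_eigenvalueFinset hreg)
  exact le_antisymm ((le_abs_self _).trans
    (abs_le_degree_of_mem_eigenvalueFinset hreg (eigenvalue_mem (i.zero_le.trans_lt hi))))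
    (hik ▸ eigenvalue_le_eigenvalue i.zero_le hi)

theorem eigenvalue_rev (hbip : Γ.IsBipartite) (i : Fin (eigenvalueFinset Γ).card) :
    eigenvalue Γ i.rev = -eigenvalue Γ i := by
  have hrev := Finset.orderEmbOfFin_unique (s := eigenvalueFinset Γ) rfl
    (f := fun i => eigenvalue Γ i.rev) (fun i => eigenvalue_mem i.rev.isLt) fun i j hij =>
      eigenvalue_lt_eigenvalue (Fin.rev_lt_rev.mpr hij) i.rev.isLt
  have hneg := Finset.orderEmbOfFin_unique (s := eigenvalueFinset Γ) rfl
    (f := fun i => -eigenvalue Γ i)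
    (fun i => neg_mem_eigenvalueFinset hbip (eigenvalue_mem i.isLt)) fun i j hij =>
      neg_lt_neg (eigenvalue_lt_eigenvalue hij j.isLt)
  exact congrFun (hrev.trans hneg.symm) i

/-! ### Comparison of the eigenvalues with `b₂` -/

namespace IsDistanceRegularWith

theorem adjMatrix_sq (hΓ : IsDistanceRegularWith Γ D p) (hbip : Γ.IsBipartite)
    (hreg : Γ.IsRegularOfDegree k) :
    Γ.adjMatrix ℂ ^ 2 = (k : ℂ) • 1 + (cNum p 2 : ℂ) • distMatrix Γ 2 := by
  ext y z
  rw [sq, Matrix.add_apply, Matrix.smul_apply, Matrix.smul_apply, distMatrix, Matrix.of_apply]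
  by_cases hyz : y = z
  · subst hyz
    rw [SimpleGraph.adjMatrix_mul_self_apply_self, hreg.degree_eq]
    simp
  have hsum : (Γ.adjMatrix ℂ * Γ.adjMatrix ℂ) y z =
      ((Γ.neighborFinset y).filter fun w => Γ.dist w z = 1).card := by
    simp only [SimpleGraph.adjMatrix_mul_apply, SimpleGraph.adjMatrix_apply, Finset.sum_boole,
      SimpleGraph.dist_eq_one_iff_adj]
  rw [hsum, Matrix.one_apply_ne hyz, smul_zero, zero_add, smul_eq_mul, mul_ite, mul_one, mul_zero]
  split_ifs with htwo
  · have hD := hΓ.dist_le y z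
    rw [hΓ.card_neighborFinset_filter (by omega) (by omega) htwo, cNum]
  · rw [Nat.cast_eq_zero, Finset.card_eq_zero, Finset.filter_eq_empty_iff]
    intro w hw hwz
    have hdist := dist_of_adj hΓ.connected hbip ((Γ.mem_neighborFinset y w).mp hw) z
    exact hyz (hΓ.connected.dist_eq_zero_iff.mp (by omega))

theorem adjMatrix_pow_four_apply_self (hΓ : IsDistanceRegularWith Γ D p) (hbip : Γ.IsBipartite)
    (hreg : Γ.IsRegularOfDegree k) (y : X) :
    (Γ.adjMatrix ℂ ^ 4) y y = cNum p 2 * k ^ 2 + (k ^ 2 - cNum p 2 * k) := by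
  have hrow : ∑ z, (Γ.adjMatrix ℂ ^ 2) y z = k ^ 2 := by
    have hconst : Γ.adjMatrix ℂ ^ 2 *ᵥ Function.const X 1 = Function.const X ((k : ℂ) ^ 2) := by
      rw [sq, ← Matrix.mulVec_mulVec]
      ext z
      simp [SimpleGraph.adjMatrix_mulVec_apply, hreg.degree_eq, sq]
    simpa [Matrix.mulVec, dotProduct] using congrFun hconst y
  have hsq (z : X) : (Γ.adjMatrix ℂ ^ 2) y z * (Γ.adjMatrix ℂ ^ 2) z y =
      cNum p 2 * (Γ.adjMatrix ℂ ^ 2) y z + if y = z then (k : ℂ) ^ 2 - cNum p 2 * k else 0 := by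
    rw [hΓ.adjMatrix_sq hbip hreg]
    by_cases hyz : y = z
    · subst hyz
      simp [distMatrix]
      ring
    · by_cases htwo : Γ.dist y z = 2 <;>
        simp [distMatrix, hyz, Ne.symm hyz, Γ.dist_comm (u := z), htwo]
  rw [show 4 = 2 + 2 from rfl, pow_add, Matrix.mul_apply, Finset.sum_congr rfl fun z _ => hsq z,
    Finset.sum_add_distrib, ← Finset.mul_sum, hrow, Finset.sum_ite_eq, if_pos (Finset.mem_univ y)]

end IsDistanceRegularWith

/-- The quartic `(t ^ 2 - β) * (κ ^ 2 - t ^ 2)`. For a bipartite distance-regular graph of valency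
`κ` with `β = b₂` its value at the adjacency matrix has trace zero, so that it takes both signs on
the spectrum. -/
def quartic (κ β : ℝ) : ℝ[X] :=
  (Polynomial.X ^ 2 - C β) * (C (κ ^ 2) - Polynomial.X ^ 2)

theorem eval_quartic (κ β t : ℝ) : (quartic κ β).eval t = (t ^ 2 - β) * (κ ^ 2 - t ^ 2) := by
  simp [quartic]

theorem natDegree_quartic (κ β : ℝ) : (quartic κ β).natDegree = 4 := by
  rw [quartic]
  compute_degree!

theorem quartic_ne_zero (κ β : ℝ) : quartic κ β ≠ 0 :=
  ne_zero_of_natDegree_gt (n := 3) (by rw [natDegree_quartic]; norm_num)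

namespace IsDistanceRegularWith

theorem trace_aeval_quartic (hΓ : IsDistanceRegularWith Γ D p) (hbip : Γ.IsBipartite)
    (hreg : Γ.IsRegularOfDegree k) (hD : 2 < D) :
    (aeval (Γ.adjMatrix ℂ) (quartic k (bNum p 2))).trace = 0 := by
  refine Finset.sum_eq_zero fun y _ => ?_
  have hexpand : quartic k (bNum p 2) = C ((k : ℝ) ^ 2 + bNum p 2) * Polynomial.X ^ 2 -
      Polynomial.X ^ 4 - C ((bNum p 2 : ℝ) * k ^ 2) := by
    simp only [quartic, C_add, C_mul, C_pow]
    ring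
  have hsq : (Γ.adjMatrix ℂ ^ 2) y y = k := by
    rw [sq, SimpleGraph.adjMatrix_mul_self_apply_self, hreg.degree_eq]
  have hsum : (k : ℂ) = cNum p 2 + bNum p 2 := by
    rw [← hΓ.cNum_add_bNum hbip hreg hD, Nat.cast_add]
  have hdiag : (aeval (Γ.adjMatrix ℂ) (quartic k (bNum p 2))) y y =
      (k ^ 2 + bNum p 2) * k - (cNum p 2 * k ^ 2 + (k ^ 2 - cNum p 2 * k)) - bNum p 2 * k ^ 2 := by
    rw [← hΓ.adjMatrix_pow_four_apply_self hbip hreg y, hexpand, map_sub, map_sub, map_mul, aeval_C,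
      aeval_C, map_pow, map_pow, aeval_X, ← Algebra.smul_def, Algebra.algebraMap_eq_smul_one]
    simp [hsq]
  rw [Matrix.diag_apply, hdiag, hsum]
  ring

theorem aeval_adjMatrix_ne_zero (hΓ : IsDistanceRegularWith Γ D p) {q : ℝ[X]} (hq : q ≠ 0)
    (hdeg : q.natDegree ≤ D) : aeval (Γ.adjMatrix ℂ) q ≠ 0 := fun haeval =>
  (diam_lt_natDegree_of_aeval_adjMatrix_eq_zero hΓ.connected hq haeval).not_ge
    (hΓ.diam_eq.symm ▸ hdeg)

theorem exists_bNum_two_lt_sq (hΓ : IsDistanceRegularWith Γ D p) (hbip : Γ.IsBipartite)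
    (hreg : Γ.IsRegularOfDegree k) (hD : 4 ≤ D) :
    ∃ t ∈ eigenvalueFinset Γ, (bNum p 2 : ℝ) < t ^ 2 ∧ t ^ 2 < (k : ℝ) ^ 2 := by
  obtain ⟨t, ht, hpos⟩ := exists_eval_pos_of_trace_eq_zero (Γ.isHermitian_adjMatrix ℂ)
    (hΓ.trace_aeval_quartic hbip hreg (by omega))
    (hΓ.aeval_adjMatrix_ne_zero (quartic_ne_zero _ _) (by rwa [natDegree_quartic]))
  rw [← mem_eigenvalueFinset_iff] at ht
  rw [eval_quartic] at hpos
  have hle : t ^ 2 ≤ (k : ℝ) ^ 2 :=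
    sq_le_sq' (abs_le.mp (abs_le_degree_of_mem_eigenvalueFinset hreg ht)).1
      (abs_le.mp (abs_le_degree_of_mem_eigenvalueFinset hreg ht)).2
  refine ⟨t, ht, ?_, ?_⟩ <;> nlinarith

theorem exists_sq_lt_bNum_two (hΓ : IsDistanceRegularWith Γ D p) (hbip : Γ.IsBipartite)
    (hreg : Γ.IsRegularOfDegree k) (hD : 4 ≤ D) :
    ∃ t ∈ eigenvalueFinset Γ, t ^ 2 < (bNum p 2 : ℝ) := by
  obtain ⟨t, ht, hneg⟩ := exists_eval_neg_of_trace_eq_zero (Γ.isHermitian_adjMatrix ℂ)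
    (hΓ.trace_aeval_quartic hbip hreg (by omega))
    (hΓ.aeval_adjMatrix_ne_zero (quartic_ne_zero _ _) (by rwa [natDegree_quartic]))
  rw [← mem_eigenvalueFinset_iff] at ht
  rw [eval_quartic] at hneg
  have hle : t ^ 2 ≤ (k : ℝ) ^ 2 :=
    sq_le_sq' (abs_le.mp (abs_le_degree_of_mem_eigenvalueFinset hreg ht)).1
      (abs_le.mp (abs_le_degree_of_mem_eigenvalueFinset hreg ht)).2
  exact ⟨t, ht, by nlinarith⟩

theorem lt_card_eigenvalueFinset (hΓ : IsDistanceRegularWith Γ D p) {i : ℕ} (hi : i ≤ D) :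
    i < (eigenvalueFinset Γ).card := by
  rw [hΓ.card_eigenvalueFinset]
  omega

theorem eigenvalue_sub (hΓ : IsDistanceRegularWith Γ D p) (hbip : Γ.IsBipartite) {i : ℕ}
    (hi : i ≤ D) : eigenvalue Γ (D - i) = -eigenvalue Γ i := by
  have hrev := eigenvalue_rev hbip ⟨i, hΓ.lt_card_eigenvalueFinset hi⟩
  simp only [Fin.val_rev, hΓ.card_eigenvalueFinset, Nat.add_sub_add_right] at hrev
  exact hrev

theorem eigenvalue_pos (hΓ : IsDistanceRegularWith Γ D p) (hbip : Γ.IsBipartite) {i : ℕ}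
    (hi : 2 * i < D) : 0 < eigenvalue Γ i := by
  have hlt := eigenvalue_lt_eigenvalue (Γ := Γ) (i := i) (j := D - i) (by omega)
    (hΓ.lt_card_eigenvalueFinset (by omega))
  rw [hΓ.eigenvalue_sub hbip (by omega)] at hlt
  linarith

theorem eigenvalue_lt_degree (hΓ : IsDistanceRegularWith Γ D p) (hreg : Γ.IsRegularOfDegree k)
    {i : ℕ} (hi : 0 < i) (hiD : i ≤ D) : eigenvalue Γ i < k := by
  have := hΓ.connected.nonempty
  rw [← eigenvalue_zero hreg]
  exact eigenvalue_lt_eigenvalue hi (hΓ.lt_card_eigenvalueFinset hiD)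

theorem eigenvalue_sq_lt_degree_sq (hΓ : IsDistanceRegularWith Γ D p) (hbip : Γ.IsBipartite)
    (hreg : Γ.IsRegularOfDegree k) {i : ℕ} (hi : 0 < i) (hiD : 2 * i < D) :
    eigenvalue Γ i ^ 2 < (k : ℝ) ^ 2 :=
  pow_lt_pow_left₀ (hΓ.eigenvalue_lt_degree hreg hi (by omega)) (hΓ.eigenvalue_pos hbip hiD).le
    two_ne_zero

theorem bNum_two_lt_eigenvalue_one_sq (hΓ : IsDistanceRegularWith Γ D p) (hbip : Γ.IsBipartite)
    (hreg : Γ.IsRegularOfDegree k) (hD : 4 ≤ D) : (bNum p 2 : ℝ) < eigenvalue Γ 1 ^ 2 := by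
  have := hΓ.connected.nonempty
  obtain ⟨t, ht, hbt, htk⟩ := hΓ.exists_bNum_two_lt_sq hbip hreg hD
  obtain ⟨i, hi, rfl⟩ := exists_eigenvalue_eq ht
  rw [hΓ.card_eigenvalueFinset] at hi
  have hi_zero : i ≠ 0 := by
    rintro rfl
    exact htk.ne (by rw [eigenvalue_zero hreg])
  have hi_last : i ≠ D := by
    rintro rfl
    have := hΓ.eigenvalue_sub hbip i.zero_le
    rw [Nat.sub_zero, eigenvalue_zero hreg] at this
    exact htk.ne (by rw [this, neg_sq])
  have hle : eigenvalue Γ i ≤ eigenvalue Γ 1 :=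
    eigenvalue_le_eigenvalue (by omega) (hΓ.lt_card_eigenvalueFinset (by omega))
  have hge : -eigenvalue Γ 1 ≤ eigenvalue Γ i := by
    rw [← hΓ.eigenvalue_sub hbip (by omega)]
    exact eigenvalue_le_eigenvalue (by omega) (hΓ.lt_card_eigenvalueFinset (by omega))
  exact hbt.trans_le (sq_le_sq' hge hle)

theorem eigenvalue_half_sq_lt_bNum_two (hΓ : IsDistanceRegularWith Γ D p) (hbip : Γ.IsBipartite)
    (hreg : Γ.IsRegularOfDegree k) (hD : 4 ≤ D) (hodd : Odd D) :
    eigenvalue Γ (D / 2) ^ 2 < (bNum p 2 : ℝ) := by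
  obtain ⟨t, ht, htb⟩ := hΓ.exists_sq_lt_bNum_two hbip hreg hD
  obtain ⟨i, hi, rfl⟩ := exists_eigenvalue_eq ht
  obtain ⟨d, rfl⟩ := hodd
  rw [hΓ.card_eigenvalueFinset] at hi
  rw [show (2 * d + 1) / 2 = d by omega]
  have hpos := hΓ.eigenvalue_pos hbip (show 2 * d < 2 * d + 1 by omega)
  refine lt_of_le_of_lt (sq_le_sq.mpr ?_) htb
  rw [abs_of_pos hpos, le_abs]
  rcases le_or_gt i d with hid | hid
  · exact .inl (eigenvalue_le_eigenvalue hid (hΓ.lt_card_eigenvalueFinset (by omega)))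
  · right
    rw [le_neg, ← hΓ.eigenvalue_sub hbip (by omega)]
    exact eigenvalue_le_eigenvalue (by omega) (hΓ.lt_card_eigenvalueFinset (by omega))

end IsDistanceRegularWith

/-! ### Primitive idempotents and cosine sequences -/

/-- The primitive idempotent of the Bose–Mesner algebra for the eigenvalue `θ`, as the Lagrange
interpolation polynomial of `θ` evaluated at the adjacency matrix. -/
def primitiveIdempotent (Γ : SimpleGraph X) [DecidableRel Γ.Adj] (θ : ℝ) : Matrix X X ℂ :=
  aeval (Γ.adjMatrix ℂ) (Lagrange.basis (eigenvalueFinset Γ) id θ)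

theorem primitiveIdempotent_mem_boseMesner (θ : ℝ) : primitiveIdempotent Γ θ ∈ boseMesner Γ := by
  rw [primitiveIdempotent, ← aeval_map_algebraMap ℂ]
  exact aeval_mem_adjoin_singleton ℂ _

theorem eval_basis_eigenvalueFinset {θ t : ℝ} (ht : t ∈ eigenvalueFinset Γ) :
    (Lagrange.basis (eigenvalueFinset Γ) id θ).eval t = if t = θ then 1 else 0 := by
  split_ifs with h
  · subst h
    exact Lagrange.eval_basis_self (v := id) Function.injective_id.injOn ht
  · exact Lagrange.eval_basis_of_ne (v := id) (Ne.symm h) ht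

theorem isStarProjection_primitiveIdempotent (θ : ℝ) :
    IsStarProjection (primitiveIdempotent Γ θ) where
  isSelfAdjoint := isHermitian_aeval (Γ.isHermitian_adjMatrix ℂ) _
  isIdempotentElem := by
    rw [IsIdempotentElem, primitiveIdempotent, ← map_mul, ← sub_eq_zero, ← map_sub]
    refine aeval_adjMatrix_eq_zero fun t ht => ?_
    rw [eval_sub, eval_mul, eval_basis_eigenvalueFinset ht]
    split_ifs <;> norm_num

theorem adjMatrix_mul_primitiveIdempotent (θ : ℝ) :
    Γ.adjMatrix ℂ * primitiveIdempotent Γ θ = θ • primitiveIdempotent Γ θ := by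
  have hzero : aeval (Γ.adjMatrix ℂ)
      ((Polynomial.X - C θ) * Lagrange.basis (eigenvalueFinset Γ) id θ) = 0 := by
    refine aeval_adjMatrix_eq_zero fun t ht => ?_
    rw [eval_mul, eval_basis_eigenvalueFinset ht]
    split_ifs with h <;> simp [h]
  rwa [map_mul, map_sub, aeval_X, aeval_C, sub_mul, ← Algebra.smul_def, sub_eq_zero] at hzero

theorem IsDistanceRegularWith.primitiveIdempotent_ne_zero (hΓ : IsDistanceRegularWith Γ D p)
    {θ : ℝ} (hθ : θ ∈ eigenvalueFinset Γ) : primitiveIdempotent Γ θ ≠ 0 := by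
  refine hΓ.aeval_adjMatrix_ne_zero (Lagrange.basis_ne_zero Function.injective_id.injOn hθ) ?_
  rw [Lagrange.natDegree_basis Function.injective_id.injOn hθ, hΓ.card_eigenvalueFinset]
  omega

end Spectrum

/-- `e 0, …, e D` is a nonzero multiple of the cosine sequence of `θ`: the entries of the primitive
idempotent for `θ` as a function of the distance satisfy this recurrence. -/
structure IsCosineSeq (D : ℕ) (p : ℕ → ℕ → ℕ → ℕ) (θ : ℂ) (e : ℕ → ℂ) : Prop where
  zero_ne_zero : e 0 ≠ 0
  recurrence : ∀ h < D, cNum p h * e (h - 1) + bNum p h * e (h + 1) = θ * e h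

section CosineSeq

variable [Fintype X]

namespace IsDistanceRegularWith

theorem eq_zero_of_recurrence (hΓ : IsDistanceRegularWith Γ D p) {θ : ℂ} {e : ℕ → ℂ}
    (hzero : e 0 = 0)
    (hrec : ∀ h < D, cNum p h * e (h - 1) + bNum p h * e (h + 1) = θ * e h) {h : ℕ} (hh : h ≤ D) :
    e h = 0 := by
  induction h using Nat.strong_induction_on with
  | _ h ih =>
  cases h with
  | zero => exact hzero
  | succ h =>
    have hstep := hrec h (by omega)
    rw [ih (h - 1) (by omega) (by omega), ih h (by omega) (by omega), mul_zero, zero_add,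
      mul_zero] at hstep
    exact (mul_eq_zero.mp hstep).resolve_left (Nat.cast_ne_zero.mpr (hΓ.bNum_pos hh).ne')

theorem exists_isCosineSeq [DecidableEq X] [DecidableRel Γ.Adj]
    (hΓ : IsDistanceRegularWith Γ D p) (hbip : Γ.IsBipartite) {θ : ℝ}
    (hθ : θ ∈ eigenvalueFinset Γ) :
    ∃ e, IsCosineSeq D p θ e ∧ primitiveIdempotent Γ θ = ofDist Γ e := by
  obtain ⟨e, he⟩ := hΓ.exists_eq_ofDist_of_mem_boseMesner (primitiveIdempotent_mem_boseMesner θ)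
  have hrec : ∀ h < D, cNum p h * e (h - 1) + bNum p h * e (h + 1) = θ * e h := by
    intro h hh
    obtain ⟨y, z, hyz⟩ := hΓ.exists_dist_eq hh.le
    rw [← hΓ.adjMatrix_mul_ofDist_apply hbip e hyz hh, ← he, adjMatrix_mul_primitiveIdempotent,
      Matrix.smul_apply, he, ofDist_apply, hyz, Complex.real_smul]
  refine ⟨e, ⟨fun hzero => hΓ.primitiveIdempotent_ne_zero hθ ?_, hrec⟩, he⟩
  ext y z
  rw [he, ofDist_apply, hΓ.eq_zero_of_recurrence hzero hrec (hΓ.dist_le y z), Matrix.zero_apply]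

end IsDistanceRegularWith

namespace IsCosineSeq

variable {θ : ℂ} {e : ℕ → ℂ}

theorem succ_ne_zero_of_eq_zero (he : IsCosineSeq D p θ e) (hΓ : IsDistanceRegularWith Γ D p)
    {h : ℕ} (hh : h + 1 ≤ D) (hzero : e h = 0) : e (h + 1) ≠ 0 := by
  induction h with
  | zero => exact absurd hzero he.zero_ne_zero
  | succ h ih =>
    intro hsucc
    refine ih (by omega) ?_ hzero
    have hstep := he.recurrence (h + 1) (by omega)
    rw [hsucc, hzero, mul_zero, mul_zero, add_zero, Nat.add_sub_cancel] at hstep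
    exact (mul_eq_zero.mp hstep).resolve_left
      (Nat.cast_ne_zero.mpr (hΓ.cNum_pos (by omega)).ne')

variable [DecidableRel Γ.Adj]

theorem mul_eq_of_eq (he : IsCosineSeq D p θ e) (hΓ : IsDistanceRegularWith Γ D p)
    (hbip : Γ.IsBipartite) (hreg : Γ.IsRegularOfDegree k) {h : ℕ} (hh : h < D)
    (heq : e (h - 1) = e (h + 1)) : θ * e h = k * e (h + 1) := by
  rw [← he.recurrence h hh, heq, ← add_mul, ← Nat.cast_add, hΓ.cNum_add_bNum hbip hreg hh]

theorem not_eq_and_eq (he : IsCosineSeq D p θ e) (hΓ : IsDistanceRegularWith Γ D p)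
    (hbip : Γ.IsBipartite) (hreg : Γ.IsRegularOfDegree k) (hθ : θ ≠ 0)
    (hθk : θ ^ 2 ≠ (k : ℂ) ^ 2) {m : ℕ} (hm : m + 4 ≤ D) :
    ¬(e m = e (m + 2) ∧ e (m + 2) = e (m + 4)) := by
  rintro ⟨hleft, hright⟩
  have hone : θ * e (m + 1) = k * e (m + 2) :=
    he.mul_eq_of_eq hΓ hbip hreg (h := m + 1) (by omega) hleft
  have hthree : θ * e (m + 3) = k * e (m + 2) := by
    rw [hright]
    exact he.mul_eq_of_eq hΓ hbip hreg (h := m + 3) (by omega) hright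
  have hodd : e (m + 1) = e (m + 3) := mul_left_cancel₀ hθ (hone.trans hthree.symm)
  have htwo : θ * e (m + 2) = k * e (m + 3) :=
    he.mul_eq_of_eq hΓ hbip hreg (h := m + 2) (by omega) hodd
  have hzero : e (m + 2) = 0 := by
    refine (mul_eq_zero.mp ?_).resolve_left (sub_ne_zero.mpr hθk)
    linear_combination θ * htwo + k * hthree
  rw [hzero, mul_zero] at hone
  exact he.succ_ne_zero_of_eq_zero hΓ (by omega) ((mul_eq_zero.mp hone).resolve_left hθ) hzero

theorem bNum_mul_sub (he : IsCosineSeq D p θ e) (hΓ : IsDistanceRegularWith Γ D p)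
    (hbip : Γ.IsBipartite) (hreg : Γ.IsRegularOfDegree k) {h : ℕ} (hh : h < D) :
    bNum p h * (e (h - 1) - e (h + 1)) = k * e (h - 1) - θ * e h := by
  rw [← he.recurrence h hh, ← hΓ.cNum_add_bNum hbip hreg hh]
  push_cast
  ring

theorem mul_sub_eq (he : IsCosineSeq D p θ e) (hΓ : IsDistanceRegularWith Γ D p)
    (hbip : Γ.IsBipartite) (hreg : Γ.IsRegularOfDegree k) (hD : 4 ≤ D) :
    (θ ^ 2 - bNum p 2) * (e 0 - e 2) = bNum p 2 * bNum p 3 * (e 2 - e 4) := by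
  have hzero : k * e 1 = θ * e 0 := by
    rw [← he.recurrence 0 (by omega), ← hΓ.cNum_add_bNum hbip hreg (h := 0) (by omega),
      hΓ.cNum_zero (by omega), Nat.cast_zero, zero_mul, zero_add, zero_add, zero_add]
  have hone : k * e 2 = θ * e 1 - (e 0 - e 2) := by
    rw [← he.recurrence 1 (by omega), ← hΓ.cNum_add_bNum hbip hreg (h := 1) (by omega),
      hΓ.cNum_one (by omega)]
    push_cast
    ring
  have htwo : bNum p 2 * (e 1 - e 3) = k * e 1 - θ * e 2 :=
    he.bNum_mul_sub hΓ hbip hreg (h := 2) (by omega)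
  have hthree : bNum p 3 * (e 2 - e 4) = k * e 2 - θ * e 3 :=
    he.bNum_mul_sub hΓ hbip hreg (h := 3) (by omega)
  rw [hzero] at htwo
  rw [hone] at hthree
  linear_combination (-θ) * htwo - bNum p 2 * hthree

theorem tilde_relation {θ : ℝ} (he : IsCosineSeq D p θ e) (hΓ : IsDistanceRegularWith Γ D p)
    (hbip : Γ.IsBipartite) (hreg : Γ.IsRegularOfDegree k) (hD : 4 ≤ D)
    (hb : θ ^ 2 ≠ (bNum p 2 : ℝ)) :
    e 0 + tilde p θ * e 2 - (1 + tilde p θ) * e 4 = 0 := by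
  have hne : (θ : ℂ) ^ 2 - bNum p 2 ≠ 0 := sub_ne_zero.mpr (by exact_mod_cast hb)
  have htilde : (1 + tilde p θ : ℂ) * ((θ : ℂ) ^ 2 - bNum p 2) = -(bNum p 2 * bNum p 3) := by
    rw [tilde]
    push_cast
    field_simp
    ring
  refine (mul_eq_zero.mp ?_).resolve_left hne
  linear_combination he.mul_sub_eq hΓ hbip hreg hD + (e 2 - e 4) * htilde

end IsCosineSeq

end CosineSeq

/-! ### Orthogonal complements in the standard module -/

section Perp

variable [Fintype X]

/-- The orthogonal complement of `W` in `ℂ^X` for the Hermitian form `⟨w, u⟩ = wᵗ ū`. Mathlib's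
`Wᗮ` does not apply, because `X → ℂ` carries the supremum norm. -/
def perp (W : Submodule ℂ (X → ℂ)) : Submodule ℂ (X → ℂ) where
  carrier := {u | ∀ w ∈ W, w ⬝ᵥ star u = 0}
  add_mem' ha hb w hw := by rw [star_add, dotProduct_add, ha w hw, hb w hw, add_zero]
  zero_mem' w _ := by rw [star_zero, dotProduct_zero]
  smul_mem' c a ha w hw := by rw [star_smul, dotProduct_smul, ha w hw, smul_zero]

open ComplexOrder in
theorem inf_perp_eq_bot (W : Submodule ℂ (X → ℂ)) : W ⊓ perp W = ⊥ := by
  rw [eq_bot_iff]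
  rintro u ⟨hu, hu'⟩
  exact dotProduct_star_self_eq_zero.mp ((dotProduct_comm _ _).trans (hu' u hu))

theorem le_perp_comm {W W' : Submodule ℂ (X → ℂ)} : W ≤ perp W' ↔ W' ≤ perp W := by
  suffices ∀ {W W' : Submodule ℂ (X → ℂ)}, W ≤ perp W' → W' ≤ perp W from ⟨this, this⟩
  intro W W' h u hu w hw
  rw [Matrix.dotProduct_star, h hw u hu, star_zero]

theorem eq_bot_of_le_perp {W W' : Submodule ℂ (X → ℂ)} (hle : W' ≤ W) (hperp : W' ≤ perp W) :
    W' = ⊥ :=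
  le_bot_iff.mp ((le_inf hle hperp).trans (inf_perp_eq_bot W).le)

theorem sup_perp_eq_top (W : Submodule ℂ (X → ℂ)) : W ⊔ perp W = ⊤ := by
  rw [eq_top_iff]
  intro u _
  let e := WithLp.linearEquiv 2 ℂ (X → ℂ)
  let W₂ : Submodule ℂ (EuclideanSpace ℂ X) := W.comap e.toLinearMap
  obtain ⟨a, ha, b, hb, hab⟩ := W₂.exists_add_mem_mem_orthogonal (e.symm u)
  refine Submodule.mem_sup.mpr ⟨e a, ha, e b, fun w hw => ?_, ?_⟩
  · exact (EuclideanSpace.inner_eq_star_dotProduct b (e.symm w)).symm.trans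
      ((W₂.mem_orthogonal' b).mp hb (e.symm w) hw)
  · rw [← map_add, ← hab, LinearEquiv.apply_symm_apply]

theorem sup_inf_perp {W W' : Submodule ℂ (X → ℂ)} (hle : W' ≤ W) :
    W' ⊔ (W ⊓ perp W') = W := by
  rw [inf_comm, ← sup_inf_assoc_of_le _ hle, sup_perp_eq_top, top_inf_eq]

theorem mulVec_mem_perp {W : Submodule ℂ (X → ℂ)} {B : Matrix X X ℂ} (hB : B.IsHermitian)
    (hW : ∀ w ∈ W, B *ᵥ w ∈ W) {u : X → ℂ} (hu : u ∈ perp W) : B *ᵥ u ∈ perp W := by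
  intro w hw
  rw [Matrix.star_mulVec, hB.eq, dotProduct_comm, ← Matrix.dotProduct_mulVec, dotProduct_comm]
  exact hu _ (hW w hw)

open ComplexOrder in
theorem mulVec_eq_zero_of_isStarProjection {E : Matrix X X ℂ} (hE : IsStarProjection E)
    {v : X → ℂ} (hv : star v ⬝ᵥ E *ᵥ v = 0) : E *ᵥ v = 0 := by
  have hherm : Eᴴ = E := hE.isSelfAdjoint
  rw [← dotProduct_star_self_eq_zero, Matrix.star_mulVec, hherm, ← Matrix.dotProduct_mulVec,
    Matrix.mulVec_mulVec, hE.isIdempotentElem.eq, hv]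

end Perp

/-! ### Modules over the Terwilliger algebra -/

section TModule

variable [DecidableEq X] {x : X}

theorem isHermitian_dualIdem (i : ℕ) : (dualIdem Γ x i).IsHermitian :=
  Matrix.isHermitian_diagonal_of_self_adjoint _ <| funext fun y => by
    rw [Pi.star_apply, apply_ite star, star_one, star_zero]

variable [Fintype X]

theorem dualIdem_mulVec_apply (i : ℕ) (w : X → ℂ) (y : X) :
    (dualIdem Γ x i *ᵥ w) y = if Γ.dist x y = i then w y else 0 := by
  rw [dualIdem, Matrix.mulVec_diagonal, ite_mul, one_mul, zero_mul]

theorem dualIdem_mulVec_dualIdem_mulVec (i j : ℕ) (w : X → ℂ) :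
    dualIdem Γ x i *ᵥ dualIdem Γ x j *ᵥ w = if i = j then dualIdem Γ x j *ᵥ w else 0 := by
  ext y
  rw [apply_ite (fun u : X → ℂ => u y)]
  simp only [dualIdem_mulVec_apply, Pi.zero_apply]
  grind

theorem mem_dualPart_top_iff {i : ℕ} {v : X → ℂ} :
    v ∈ dualPart Γ x i ⊤ ↔ dualIdem Γ x i *ᵥ v = v := by
  refine ⟨?_, fun h => ⟨v, trivial, h⟩⟩
  rintro ⟨w, -, rfl⟩
  rw [Matrix.mulVecLin_apply, dualIdem_mulVec_dualIdem_mulVec, if_pos rfl]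

theorem exists_hasEndpoint_of_dualPart_ne_bot {W : Submodule ℂ (X → ℂ)} {i : ℕ}
    (hi : i ≤ Γ.diam) (hne : dualPart Γ x i W ≠ ⊥) : ∃ r ≤ i, HasEndpoint Γ x W r := by
  classical
  have hex : ∃ j, j ≤ Γ.diam ∧ dualPart Γ x j W ≠ ⊥ := ⟨i, hi, hne⟩
  exact ⟨Nat.find hex, Nat.find_min' hex ⟨hi, hne⟩, Nat.find_spec hex,
    fun j hj => Nat.find_min' hex hj⟩

theorem mulVec_mem_of_mem_adjoin {S : Set (Matrix X X ℂ)} {W : Submodule ℂ (X → ℂ)}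
    (hS : ∀ B ∈ S, ∀ w ∈ W, B *ᵥ w ∈ W) {B : Matrix X X ℂ} (hB : B ∈ Algebra.adjoin ℂ S) {w : X → ℂ}
    (hw : w ∈ W) : B *ᵥ w ∈ W := by
  induction hB using Algebra.adjoin_induction generalizing w with
  | mem B hB => exact hS B hB w hw
  | algebraMap c =>
    rw [Algebra.algebraMap_eq_smul_one, Matrix.smul_mulVec, Matrix.one_mulVec]
    exact W.smul_mem c hw
  | add B C _ _ hB hC =>
    rw [Matrix.add_mulVec]
    exact W.add_mem (hB hw) (hC hw)
  | mul B C _ _ hB hC =>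
    rw [← Matrix.mulVec_mulVec]
    exact hB (hC hw)

variable [DecidableRel Γ.Adj]

theorem isTModule_iff {W : Submodule ℂ (X → ℂ)} :
    IsTModule Γ x W ↔
      (∀ w ∈ W, Γ.adjMatrix ℂ *ᵥ w ∈ W) ∧ ∀ i, ∀ w ∈ W, dualIdem Γ x i *ᵥ w ∈ W := by
  refine ⟨fun h => ⟨h _ ?_, fun i => h _ ?_⟩, ?_⟩
  · exact (le_sup_left : boseMesner Γ ≤ terwilliger Γ x) (Algebra.subset_adjoin rfl)
  · exact (le_sup_right : dualBoseMesner Γ x ≤ terwilliger Γ x) (Algebra.subset_adjoin ⟨i, rfl⟩)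
  · rintro ⟨hA, hdual⟩ B hB w hw
    rw [terwilliger, boseMesner, dualBoseMesner, ← Algebra.adjoin_union] at hB
    refine mulVec_mem_of_mem_adjoin ?_ hB hw
    rintro C (rfl | ⟨i, rfl⟩)
    · exact hA
    · exact hdual i

theorem isTModule_sSup {S : Set (Submodule ℂ (X → ℂ))} (hS : ∀ W ∈ S, IsTModule Γ x W) :
    IsTModule Γ x (sSup S) := by
  intro B hB
  suffices sSup S ≤ (sSup S).comap B.mulVecLin from fun w hw => this hw
  exact sSup_le fun W hW w hw => (le_sSup hW : W ≤ sSup S) (hS W hW B hB w hw)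

theorem isTModule_endpointSpan (r : ℕ) : IsTModule Γ x (endpointSpan Γ x r) :=
  isTModule_sSup fun _ hW => hW.1.1

namespace IsTModule

variable {W : Submodule ℂ (X → ℂ)}

theorem adjMatrix_mulVec_mem (hW : IsTModule Γ x W) {w : X → ℂ} (hw : w ∈ W) :
    Γ.adjMatrix ℂ *ᵥ w ∈ W :=
  (isTModule_iff.mp hW).1 w hw

theorem dualPart_le (hW : IsTModule Γ x W) (i : ℕ) : dualPart Γ x i W ≤ W := by
  rintro _ ⟨w, hw, rfl⟩
  exact (isTModule_iff.mp hW).2 i w hw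

protected theorem perp (hW : IsTModule Γ x W) : IsTModule Γ x (perp W) :=
  isTModule_iff.mpr ⟨fun _ => mulVec_mem_perp (Γ.isHermitian_adjMatrix ℂ) (isTModule_iff.mp hW).1,
    fun i _ => mulVec_mem_perp (isHermitian_dualIdem i) ((isTModule_iff.mp hW).2 i)⟩

theorem exists_irreducible_le (hW : IsTModule Γ x W) (hne : W ≠ ⊥) :
    ∃ W₁ ≤ W, IsIrreducibleTModule Γ x W₁ := by
  obtain ⟨W₁, ⟨hle, hT, hbot⟩, hmin⟩ := wellFounded_lt.has_min
    {W₁ : Submodule ℂ (X → ℂ) | W₁ ≤ W ∧ IsTModule Γ x W₁ ∧ W₁ ≠ ⊥} ⟨W, le_rfl, hW, hne⟩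
  refine ⟨W₁, hle, hT, hbot, fun W₂ hle₂ hT₂ => or_iff_not_imp_left.mpr fun hne₂ => ?_⟩
  exact eq_of_le_of_not_lt hle₂ (hmin W₂ ⟨hle₂.trans hle, hT₂, hne₂⟩)

end IsTModule

theorem sSup_isIrreducibleTModule_eq_top :
    sSup {W : Submodule ℂ (X → ℂ) | IsIrreducibleTModule Γ x W} = ⊤ := by
  set S := {W : Submodule ℂ (X → ℂ) | IsIrreducibleTModule Γ x W}
  have hperp : perp (sSup S) = ⊥ := by
    by_contra hne
    obtain ⟨W, hle, hW⟩ :=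
      (isTModule_sSup fun W (hW : W ∈ S) => hW.1).perp.exists_irreducible_le hne
    exact hW.2.1 (eq_bot_of_le_perp (le_sSup hW) hle)
  rw [← sup_perp_eq_top (sSup S), hperp, sup_bot_eq]

theorem dualPart_top_le_iSup_endpointSpan {i : ℕ} (hi : i ≤ Γ.diam) :
    dualPart Γ x i ⊤ ≤ ⨆ r ≤ i, endpointSpan Γ x r := by
  rw [← sSup_isIrreducibleTModule_eq_top (Γ := Γ) (x := x), sSup_eq_iSup, dualPart]
  simp only [Submodule.map_iSup]
  refine iSup₂_le fun W (hW : IsIrreducibleTModule Γ x W) => ?_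
  rw [← dualPart]
  rcases eq_or_ne (dualPart Γ x i W) ⊥ with hbot | hne
  · exact hbot.le.trans bot_le
  · obtain ⟨r, hr, hend⟩ := exists_hasEndpoint_of_dualPart_ne_bot hi hne
    have hle : W ≤ endpointSpan Γ x r := le_sSup ⟨hW, hend⟩
    exact (hW.1.dualPart_le i).trans (le_iSup₂_of_le r hr hle)

end TModule

/-! ### The module generated by a vector of a subconstituent -/

section Raise

variable [Fintype X] [DecidableEq X] [DecidableRel Γ.Adj] {x : X} {v : X → ℂ}

theorem exists_smul_eq_of_finrank_le_one {K V : Type*} [Field K] [AddCommGroup V] [Module K V]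
    [FiniteDimensional K V] {S : Submodule K V} (hS : Module.finrank K S ≤ 1) {u w : V}
    (hu : u ∈ S) (hu_ne : u ≠ 0) (hw : w ∈ S) : ∃ a : K, a • u = w := by
  have hle : K ∙ u ≤ S := (Submodule.span_singleton_le_iff_mem u S).mpr hu
  have heq : K ∙ u = S :=
    Submodule.eq_of_le_of_finrank_le hle (hS.trans_eq (finrank_span_singleton hu_ne).symm)
  exact Submodule.mem_span_singleton.mp (heq ▸ hw)

theorem mulVec_mem_span_range {ι R Y : Type*} [CommSemiring R] [Fintype Y] {B : Matrix Y Y R}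
    {f : ι → Y → R} (hB : ∀ m, B *ᵥ f m ∈ Submodule.span R (Set.range f)) :
    ∀ u ∈ Submodule.span R (Set.range f), B *ᵥ u ∈ Submodule.span R (Set.range f) := by
  change Submodule.span R (Set.range f) ≤ (Submodule.span R (Set.range f)).comap B.mulVecLin
  rw [Submodule.span_le]
  rintro _ ⟨m, rfl⟩
  exact hB m

theorem self_mem_boseMesnerOrbit : v ∈ boseMesnerOrbit Γ v :=
  ⟨1, one_mem _, Matrix.one_mulVec v⟩

theorem adjMatrix_mulVec_mem_boseMesnerOrbit {w : X → ℂ} (hw : w ∈ boseMesnerOrbit Γ v) :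
    Γ.adjMatrix ℂ *ᵥ w ∈ boseMesnerOrbit Γ v := by
  obtain ⟨B, hB, rfl⟩ := hw
  exact ⟨_, mul_mem (Algebra.subset_adjoin rfl) hB, (Matrix.mulVec_mulVec _ _ _).symm⟩

theorem boseMesnerOrbit_le {W : Submodule ℂ (X → ℂ)} (hv : v ∈ W)
    (hW : ∀ w ∈ W, Γ.adjMatrix ℂ *ᵥ w ∈ W) : boseMesnerOrbit Γ v ≤ W := by
  rintro _ ⟨B, hB, rfl⟩
  refine mulVec_mem_of_mem_adjoin ?_ hB hv
  rintro _ rfl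
  exact hW

theorem adjMatrix_mulVec_eq_add (hc : Γ.Connected) (hbip : Γ.IsBipartite) {w : X → ℂ} {i : ℕ}
    (hw : dualIdem Γ x (i + 1) *ᵥ w = w) :
    Γ.adjMatrix ℂ *ᵥ w = dualIdem Γ x i *ᵥ Γ.adjMatrix ℂ *ᵥ w +
      dualIdem Γ x (i + 2) *ᵥ Γ.adjMatrix ℂ *ᵥ w := by
  ext y
  rw [Pi.add_apply, dualIdem_mulVec_apply, dualIdem_mulVec_apply]
  by_cases hlow : Γ.dist x y = i
  · rw [if_pos hlow, if_neg (by omega), add_zero]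
  by_cases hhigh : Γ.dist x y = i + 2
  · rw [if_neg hlow, if_pos hhigh, zero_add]
  rw [if_neg hlow, if_neg hhigh, add_zero, SimpleGraph.adjMatrix_mulVec_apply]
  refine Finset.sum_eq_zero fun z hz => ?_
  have hdist := dist_of_adj hc hbip ((Γ.mem_neighborFinset y z).mp hz) x
  rw [Γ.dist_comm (u := z), Γ.dist_comm (u := y)] at hdist
  rw [← hw, dualIdem_mulVec_apply, if_neg (by omega)]

/-- For `v` in `E_r^* V`, the sequence `v, E_{r+1}^* A v, E_{r+2}^* A E_{r+1}^* A v, …`, which spans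
`M v` when `M v` is a thin `T`-module of endpoint `r`. -/
def raise (Γ : SimpleGraph X) [DecidableRel Γ.Adj] (x : X) (r : ℕ) (v : X → ℂ) : ℕ → X → ℂ
  | 0 => v
  | m + 1 => dualIdem Γ x (r + m + 1) *ᵥ Γ.adjMatrix ℂ *ᵥ raise Γ x r v m

variable {r : ℕ}

theorem dualIdem_mulVec_raise (hv : dualIdem Γ x r *ᵥ v = v) (i m : ℕ) :
    dualIdem Γ x i *ᵥ raise Γ x r v m = if i = r + m then raise Γ x r v m else 0 := by
  cases m with
  | zero => rw [raise, add_zero, ← hv, dualIdem_mulVec_dualIdem_mulVec, hv]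
  | succ m => rw [raise, dualIdem_mulVec_dualIdem_mulVec, add_assoc]

theorem raise_succ_eq_zero {m : ℕ} (hm : raise Γ x r v m = 0) : raise Γ x r v (m + 1) = 0 := by
  rw [raise, hm, Matrix.mulVec_zero, Matrix.mulVec_zero]

theorem adjMatrix_mulVec_raise_zero (hc : Γ.Connected) (hbip : Γ.IsBipartite)
    (hv : dualIdem Γ x (r + 1) *ᵥ v = v) (hlow : dualPart Γ x r (boseMesnerOrbit Γ v) = ⊥) :
    Γ.adjMatrix ℂ *ᵥ raise Γ x (r + 1) v 0 = raise Γ x (r + 1) v 1 := by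
  have hzero : dualIdem Γ x r *ᵥ Γ.adjMatrix ℂ *ᵥ v ∈ dualPart Γ x r (boseMesnerOrbit Γ v) :=
    ⟨_, adjMatrix_mulVec_mem_boseMesnerOrbit self_mem_boseMesnerOrbit, rfl⟩
  rw [hlow, Submodule.mem_bot] at hzero
  have hsplit := adjMatrix_mulVec_eq_add hc hbip hv
  rwa [hzero, zero_add] at hsplit

theorem exists_adjMatrix_mulVec_raise_succ (hc : Γ.Connected) (hbip : Γ.IsBipartite)
    (hv : dualIdem Γ x r *ᵥ v = v) {W : Submodule ℂ (X → ℂ)}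
    (hA : ∀ w ∈ W, Γ.adjMatrix ℂ *ᵥ w ∈ W) {m : ℕ}
    (hthin : Module.finrank ℂ (dualPart Γ x (r + m) W) ≤ 1)
    (hm : raise Γ x r v m ∈ W) (hm_succ : raise Γ x r v (m + 1) ∈ W) :
    ∃ a : ℂ, Γ.adjMatrix ℂ *ᵥ raise Γ x r v (m + 1) =
      a • raise Γ x r v m + raise Γ x r v (m + 2) := by
  rcases eq_or_ne (raise Γ x r v m) 0 with hzero | hne
  · have hzero_succ := raise_succ_eq_zero hzero
    exact ⟨0, by rw [hzero_succ, raise_succ_eq_zero hzero_succ, Matrix.mulVec_zero, zero_smul,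
      add_zero]⟩
  have hself : raise Γ x r v m ∈ dualPart Γ x (r + m) W :=
    ⟨_, hm, (dualIdem_mulVec_raise hv _ m).trans (if_pos rfl)⟩
  have hlower : dualIdem Γ x (r + m) *ᵥ Γ.adjMatrix ℂ *ᵥ raise Γ x r v (m + 1) ∈
      dualPart Γ x (r + m) W := ⟨_, hA _ hm_succ, rfl⟩
  obtain ⟨a, ha⟩ : ∃ a : ℂ, a • raise Γ x r v m = _ :=
    exists_smul_eq_of_finrank_le_one hthin hself hne hlower
  refine ⟨a, ?_⟩
  rw [ha]
  exact adjMatrix_mulVec_eq_add hc hbip ((dualIdem_mulVec_raise hv _ (m + 1)).trans (if_pos rfl))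

theorem raise_mem_boseMesnerOrbit (hc : Γ.Connected) (hbip : Γ.IsBipartite)
    (hv : dualIdem Γ x (r + 1) *ᵥ v = v) (hlow : dualPart Γ x r (boseMesnerOrbit Γ v) = ⊥)
    (hthin : ∀ i, Module.finrank ℂ (dualPart Γ x i (boseMesnerOrbit Γ v)) ≤ 1) (m : ℕ) :
    raise Γ x (r + 1) v m ∈ boseMesnerOrbit Γ v := by
  induction m using Nat.strong_induction_on with
  | _ m ih =>
  match m with
  | 0 => exact self_mem_boseMesnerOrbit
  | 1 =>
    rw [← adjMatrix_mulVec_raise_zero hc hbip hv hlow]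
    exact adjMatrix_mulVec_mem_boseMesnerOrbit (ih 0 one_pos)
  | m + 2 =>
    obtain ⟨a, ha⟩ := exists_adjMatrix_mulVec_raise_succ hc hbip hv
      (fun _ => adjMatrix_mulVec_mem_boseMesnerOrbit) (hthin _) (ih m (by omega))
      (ih (m + 1) (by omega))
    rw [← sub_eq_iff_eq_add'.mpr ha]
    exact sub_mem (adjMatrix_mulVec_mem_boseMesnerOrbit (ih (m + 1) (by omega)))
      (Submodule.smul_mem _ a (ih m (by omega)))

theorem adjMatrix_mulVec_raise_mem_span (hc : Γ.Connected) (hbip : Γ.IsBipartite)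
    (hv : dualIdem Γ x (r + 1) *ᵥ v = v) (hlow : dualPart Γ x r (boseMesnerOrbit Γ v) = ⊥)
    (hthin : ∀ i, Module.finrank ℂ (dualPart Γ x i (boseMesnerOrbit Γ v)) ≤ 1) (m : ℕ) :
    Γ.adjMatrix ℂ *ᵥ raise Γ x (r + 1) v m ∈
      Submodule.span ℂ (Set.range (raise Γ x (r + 1) v)) := by
  have hmem (m : ℕ) := raise_mem_boseMesnerOrbit hc hbip hv hlow hthin m
  have hspan (m : ℕ) : raise Γ x (r + 1) v m ∈
    Submodule.span ℂ (Set.range (raise Γ x (r + 1) v)) := Submodule.subset_span ⟨m, rfl⟩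
  cases m with
  | zero =>
    rw [adjMatrix_mulVec_raise_zero hc hbip hv hlow]
    exact hspan 1
  | succ m =>
    obtain ⟨a, ha⟩ := exists_adjMatrix_mulVec_raise_succ hc hbip hv
      (fun _ => adjMatrix_mulVec_mem_boseMesnerOrbit) (hthin _) (hmem m) (hmem (m + 1))
    rw [ha]
    exact add_mem (Submodule.smul_mem _ a (hspan m)) (hspan (m + 2))

theorem boseMesnerOrbit_eq_span_raise (hc : Γ.Connected) (hbip : Γ.IsBipartite)
    (hv : dualIdem Γ x (r + 1) *ᵥ v = v) (hlow : dualPart Γ x r (boseMesnerOrbit Γ v) = ⊥)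
    (hthin : ∀ i, Module.finrank ℂ (dualPart Γ x i (boseMesnerOrbit Γ v)) ≤ 1) :
    boseMesnerOrbit Γ v = Submodule.span ℂ (Set.range (raise Γ x (r + 1) v)) := by
  refine le_antisymm (boseMesnerOrbit_le (Submodule.subset_span ⟨0, rfl⟩) ?_) ?_
  · exact mulVec_mem_span_range (adjMatrix_mulVec_raise_mem_span hc hbip hv hlow hthin)
  · rw [Submodule.span_le, Set.range_subset_iff]
    exact raise_mem_boseMesnerOrbit hc hbip hv hlow hthin

theorem isTModule_boseMesnerOrbit (hc : Γ.Connected) (hbip : Γ.IsBipartite)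
    (hv : dualIdem Γ x (r + 1) *ᵥ v = v) (hlow : dualPart Γ x r (boseMesnerOrbit Γ v) = ⊥)
    (hthin : ∀ i, Module.finrank ℂ (dualPart Γ x i (boseMesnerOrbit Γ v)) ≤ 1) :
    IsTModule Γ x (boseMesnerOrbit Γ v) := by
  refine isTModule_iff.mpr ⟨fun _ => adjMatrix_mulVec_mem_boseMesnerOrbit, fun i => ?_⟩
  rw [boseMesnerOrbit_eq_span_raise hc hbip hv hlow hthin]
  refine mulVec_mem_span_range fun m => ?_
  rw [dualIdem_mulVec_raise hv]
  split_ifs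
  · exact Submodule.subset_span ⟨m, rfl⟩
  · exact Submodule.zero_mem _

theorem isIrreducibleTModule_boseMesnerOrbit (hv_ne : v ≠ 0)
    (hpart : dualPart Γ x r (boseMesnerOrbit Γ v) = ℂ ∙ v)
    (hT : IsTModule Γ x (boseMesnerOrbit Γ v)) :
    IsIrreducibleTModule Γ x (boseMesnerOrbit Γ v) := by
  have horbit_le {W : Submodule ℂ (X → ℂ)} (hW : IsTModule Γ x W) (hvW : v ∈ W) :
      boseMesnerOrbit Γ v ≤ W := boseMesnerOrbit_le hvW (fun _ => hW.adjMatrix_mulVec_mem)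
  have hv : dualIdem Γ x r *ᵥ v = v := mem_dualPart_top_iff.mp <|
    Submodule.map_mono le_top (hpart ▸ Submodule.mem_span_singleton_self v)
  refine ⟨hT, fun hbot => hv_ne ((Submodule.mem_bot ℂ).mp (hbot ▸ self_mem_boseMesnerOrbit)),
    fun W hle hW => ?_⟩
  obtain ⟨a, ha, b, hb, hab⟩ := Submodule.mem_sup.mp
    ((sup_inf_perp hle).symm ▸ self_mem_boseMesnerOrbit : v ∈ W ⊔ (boseMesnerOrbit Γ v ⊓ perp W))
  obtain ⟨c, hc⟩ : ∃ c : ℂ, c • v = dualIdem Γ x r *ᵥ a :=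
    Submodule.mem_span_singleton.mp (hpart ▸ ⟨a, hle ha, rfl⟩)
  have ha' : c • v ∈ W := hc ▸ hW.dualPart_le r ⟨a, ha, rfl⟩
  rcases eq_or_ne c 0 with rfl | hc_ne
  · left
    have hvb : v = dualIdem Γ x r *ᵥ b := by
      rw [← zero_add (_ *ᵥ b), ← zero_smul ℂ v, hc, ← Matrix.mulVec_add, hab, hv]
    have hv_perp : v ∈ perp W := hvb ▸ hW.perp.dualPart_le r ⟨b, hb.2, rfl⟩
    exact eq_bot_of_le_perp le_rfl (hle.trans (horbit_le hW.perp hv_perp))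
  · right
    exact hle.antisymm (horbit_le hW ((Submodule.smul_mem_iff W hc_ne).mp ha'))

end Raise

/-! ### Distance matrices on the second subconstituent -/

section SecondSubconstituent

variable [Fintype X] [DecidableEq X] {x : X} {v : X → ℂ}

theorem distMatrix_mulVec_apply_self {r : ℕ} (hv : dualIdem Γ x r *ᵥ v = v) :
    (distMatrix Γ r *ᵥ v) x = ∑ z, v z := by
  rw [Matrix.mulVec, dotProduct]
  refine Finset.sum_congr rfl fun z _ => ?_
  rw [← hv, dualIdem_mulVec_apply, distMatrix, Matrix.of_apply]
  split_ifs <;> simp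

theorem dualIdem_mulVec_ofDist_mulVec (hc : Γ.Connected) (hbip : Γ.IsBipartite)
    (hv : dualIdem Γ x 2 *ᵥ v = v) (u : ℕ → ℂ) (m : ℕ) :
    dualIdem Γ x (m + 2) *ᵥ ofDist Γ u *ᵥ v =
      u m • dualIdem Γ x (m + 2) *ᵥ distMatrix Γ m *ᵥ v +
      u (m + 2) • dualIdem Γ x (m + 2) *ᵥ distMatrix Γ (m + 2) *ᵥ v +
      u (m + 4) • dualIdem Γ x (m + 2) *ᵥ distMatrix Γ (m + 4) *ᵥ v := by
  ext y
  simp only [Pi.add_apply, Pi.smul_apply, dualIdem_mulVec_apply, smul_eq_mul]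
  split_ifs with hy
  swap
  · simp only [mul_zero, add_zero]
  simp only [Matrix.mulVec, dotProduct, Finset.mul_sum, ← Finset.sum_add_distrib]
  refine Finset.sum_congr rfl fun z _ => ?_
  by_cases hz : Γ.dist x z = 2
  · have heven := Nat.even_iff.mp (even_dist_add hc hbip x y z)
    have hxy := hc.dist_triangle (u := x) (v := z) (w := y)
    have hyz := hc.dist_triangle (u := y) (v := x) (w := z)
    rw [Γ.dist_comm (u := z)] at hxy
    rw [Γ.dist_comm (u := y) (v := x)] at hyz
    have hcases : Γ.dist y z = m ∨ Γ.dist y z = m + 2 ∨ Γ.dist y z = m + 4 := by omega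
    rcases hcases with h | h | h <;> simp [ofDist_apply, distMatrix, h]
  · have hvz : v z = 0 := by rw [← hv, dualIdem_mulVec_apply, if_neg hz]
    simp only [hvz, mul_zero, add_zero]

theorem dualIdem_mulVec_distMatrix_mulVec_add_eq_zero (hc : Γ.Connected) (hbip : Γ.IsBipartite)
    (hv : dualIdem Γ x 2 *ᵥ v = v) (hsum : ∑ z, v z = 0) (m : ℕ) :
    dualIdem Γ x (m + 2) *ᵥ distMatrix Γ m *ᵥ v +
      dualIdem Γ x (m + 2) *ᵥ distMatrix Γ (m + 2) *ᵥ v +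
      dualIdem Γ x (m + 2) *ᵥ distMatrix Γ (m + 4) *ᵥ v = 0 := by
  have hpieces := dualIdem_mulVec_ofDist_mulVec hc hbip hv (fun _ => 1) m
  have hones : ofDist Γ (fun _ => 1) *ᵥ v = 0 := by
    ext y
    simpa [Matrix.mulVec, dotProduct, ofDist_apply] using hsum
  rw [hones, Matrix.mulVec_zero] at hpieces
  simpa only [one_smul] using hpieces.symm

theorem dualIdem_two_mulVec_ofDist_mulVec (hc : Γ.Connected) (hbip : Γ.IsBipartite)
    (hv : dualIdem Γ x 2 *ᵥ v = v) (hsum : ∑ z, v z = 0) {η : ℂ}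
    (hη : localMatrix Γ x *ᵥ v = η • v) (u : ℕ → ℂ) :
    dualIdem Γ x 2 *ᵥ ofDist Γ u *ᵥ v = (u 0 + η * u 2 - (1 + η) * u 4) • v := by
  have hzero : dualIdem Γ x 2 *ᵥ distMatrix Γ 0 *ᵥ v = v := by
    have hone : distMatrix Γ 0 = 1 := by
      ext y z
      simp [distMatrix, Matrix.one_apply, hc.dist_eq_zero_iff]
    rw [hone, Matrix.one_mulVec, hv]
  have htwo : dualIdem Γ x 2 *ᵥ distMatrix Γ 2 *ᵥ v = η • v := by
    rw [← hη, localMatrix, ← Matrix.mulVec_mulVec, ← Matrix.mulVec_mulVec, hv]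
  have hfour := dualIdem_mulVec_distMatrix_mulVec_add_eq_zero hc hbip hv hsum 0
  rw [zero_add, zero_add, hzero, htwo] at hfour
  rw [← zero_add 2, dualIdem_mulVec_ofDist_mulVec hc hbip hv, zero_add, zero_add, hzero, htwo,
    eq_neg_of_add_eq_zero_right hfour]
  module

theorem ofDist_mulVec_eq_zero (hc : Γ.Connected) (hbip : Γ.IsBipartite)
    (hv : dualIdem Γ x 2 *ᵥ v = v) (hsum : ∑ z, v z = 0) {η : ℂ}
    (hη : localMatrix Γ x *ᵥ v = η • v) {e : ℕ → ℂ} (hE : IsStarProjection (ofDist Γ e))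
    (he : e 0 + η * e 2 - (1 + η) * e 4 = 0) : ofDist Γ e *ᵥ v = 0 := by
  refine mulVec_eq_zero_of_isStarProjection hE ?_
  have htwo := dualIdem_two_mulVec_ofDist_mulVec hc hbip hv hsum hη e
  rw [he, zero_smul] at htwo
  nth_rewrite 1 [← hv]
  rw [Matrix.star_mulVec, (isHermitian_dualIdem 2).eq, ← Matrix.dotProduct_mulVec, htwo,
    dotProduct_zero]

theorem hasLocalEigenvalue_of_dualPart_eq_span {W : Submodule ℂ (X → ℂ)} {η : ℝ} (hv_ne : v ≠ 0)
    (hpart : dualPart Γ x 2 W = ℂ ∙ v) (hη : localMatrix Γ x *ᵥ v = (η : ℂ) • v) :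
    HasLocalEigenvalue Γ x W η := by
  rw [HasLocalEigenvalue, hpart]
  refine ⟨finrank_span_singleton hv_ne, fun w hw => ?_⟩
  obtain ⟨a, rfl⟩ := Submodule.mem_span_singleton.mp hw
  rw [Matrix.mulVec_smul, hη, smul_comm]

theorem hasEndpoint_of_dualPart_eq_span {W : Submodule ℂ (X → ℂ)} {r : ℕ} (hr : r ≤ Γ.diam)
    (hv_ne : v ≠ 0) (hpart : dualPart Γ x r W = ℂ ∙ v)
    (hlow : ∀ i < r, dualPart Γ x i W = ⊥) : HasEndpoint Γ x W r := by
  refine ⟨⟨hr, ?_⟩, fun i hi => le_of_not_gt fun hir => hi.2 (hlow i hir)⟩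
  rwa [hpart, ne_eq, Submodule.span_singleton_eq_bot]

/-! ### Thinness of `M v` -/

variable [DecidableRel Γ.Adj]

theorem dualIdem_two_mulVec_of_mem_spaceU (hv : v ∈ spaceU Γ x) : dualIdem Γ x 2 *ᵥ v = v :=
  mem_dualPart_top_iff.mp hv.1

theorem mem_perp_endpointSpan_of_mem_spaceU (hv : v ∈ spaceU Γ x) {r : ℕ} (hr : r < 2) :
    v ∈ perp (endpointSpan Γ x r) := by
  intro w hw
  have hpart : dualIdem Γ x 2 *ᵥ w ∈
      dualPart Γ x 2 (endpointSpan Γ x 0) ⊔ dualPart Γ x 2 (endpointSpan Γ x 1) := by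
    interval_cases r
    · exact Submodule.mem_sup_left ⟨w, hw, rfl⟩
    · exact Submodule.mem_sup_right ⟨w, hw, rfl⟩
  calc w ⬝ᵥ star v = w ⬝ᵥ star (dualIdem Γ x 2 *ᵥ v) := by
        rw [dualIdem_two_mulVec_of_mem_spaceU hv]
    _ = dualIdem Γ x 2 *ᵥ w ⬝ᵥ star v := by
        rw [Matrix.star_mulVec, (isHermitian_dualIdem 2).eq, dotProduct_comm,
          ← Matrix.dotProduct_mulVec, dotProduct_comm]
    _ = 0 := hv.2 _ hpart

theorem dualPart_boseMesnerOrbit_eq_bot (hdiam : 1 ≤ Γ.diam) (hv : v ∈ spaceU Γ x) {i : ℕ}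
    (hi : i < 2) : dualPart Γ x i (boseMesnerOrbit Γ v) = ⊥ := by
  have hperp (r : ℕ) (hr : r ≤ i) :
      endpointSpan Γ x r ≤ perp (dualPart Γ x i (boseMesnerOrbit Γ v)) := by
    have hT : IsTModule Γ x (perp (endpointSpan Γ x r)) := (isTModule_endpointSpan r).perp
    have horbit : boseMesnerOrbit Γ v ≤ perp (endpointSpan Γ x r) :=
      boseMesnerOrbit_le (mem_perp_endpointSpan_of_mem_spaceU hv (hr.trans_lt hi))
        fun _ => hT.adjMatrix_mulVec_mem
    exact le_perp_comm.mp ((Submodule.map_mono horbit).trans (hT.dualPart_le i))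
  refine eq_bot_of_le_perp le_rfl ?_
  calc dualPart Γ x i (boseMesnerOrbit Γ v) ≤ dualPart Γ x i ⊤ := Submodule.map_mono le_top
    _ ≤ ⨆ r ≤ i, endpointSpan Γ x r := dualPart_top_le_iSup_endpointSpan (by omega)
    _ ≤ perp (dualPart Γ x i (boseMesnerOrbit Γ v)) := iSup₂_le hperp

theorem sum_eq_zero_of_mem_spaceU (hΓ : IsDistanceRegularWith Γ D p) (hbip : Γ.IsBipartite)
    (hreg : Γ.IsRegularOfDegree k) (hD : 2 ≤ D) (hv : v ∈ spaceU Γ x) : ∑ z, v z = 0 := by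
  have hsupp := dualIdem_two_mulVec_of_mem_spaceU hv
  have hvx : v x = 0 := by
    rw [← hsupp, dualIdem_mulVec_apply, SimpleGraph.dist_self, if_neg (by omega)]
  have hmem : Γ.adjMatrix ℂ *ᵥ Γ.adjMatrix ℂ *ᵥ v ∈ boseMesnerOrbit Γ v :=
    adjMatrix_mulVec_mem_boseMesnerOrbit
      (adjMatrix_mulVec_mem_boseMesnerOrbit self_mem_boseMesnerOrbit)
  have hsq : dualIdem Γ x 0 *ᵥ Γ.adjMatrix ℂ *ᵥ Γ.adjMatrix ℂ *ᵥ v = 0 := by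
    rw [← Submodule.mem_bot ℂ,
      ← dualPart_boseMesnerOrbit_eq_bot (by rw [hΓ.diam_eq]; omega) hv two_pos]
    exact ⟨_, hmem, rfl⟩
  have hdist : Γ.adjMatrix ℂ *ᵥ Γ.adjMatrix ℂ *ᵥ v =
      (k : ℂ) • v + (cNum p 2 : ℂ) • distMatrix Γ 2 *ᵥ v := by
    rw [Matrix.mulVec_mulVec, ← sq, hΓ.adjMatrix_sq hbip hreg, Matrix.add_mulVec,
      Matrix.smul_mulVec, Matrix.smul_mulVec, Matrix.one_mulVec]
  have hx : (cNum p 2 : ℂ) * ∑ z, v z = 0 := by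
    simpa only [hdist, dualIdem_mulVec_apply, SimpleGraph.dist_self, if_true, Pi.add_apply,
      Pi.smul_apply, Pi.zero_apply, smul_eq_mul, hvx, mul_zero, zero_add,
      distMatrix_mulVec_apply_self hsupp] using congrFun hsq x
  exact (mul_eq_zero.mp hx).resolve_left (Nat.cast_ne_zero.mpr (hΓ.cNum_pos hD).ne')

theorem finrank_span_triple_le_one {K V : Type*} [Field K] [AddCommGroup V] [Module K V]
    {a b c : V} {α β γ : K} (hsum : a + b + c = 0) (hrel : α • a + β • b + γ • c = 0)
    (hne : ¬(α = β ∧ β = γ)) : Module.finrank K (Submodule.span K {a, b, c}) ≤ 1 := by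
  wlog hβγ : β ≠ γ generalizing a c α γ
  · rw [Set.insert_comm, Set.pair_comm, Set.insert_comm]
    exact this (a := c) (c := a) (α := γ) (γ := α) (by rw [← hsum]; abel) (by rw [← hrel]; abel)
      (by grind) (by grind)
  have hc : c = ((α - β) / (β - γ)) • a := by
    rw [div_eq_inv_mul, mul_smul, eq_inv_smul_iff₀ (sub_ne_zero.mpr hβγ)]
    linear_combination (norm := module) β • hsum - hrel
  have hb : b = -a - c := by rw [← sub_eq_zero, ← hsum]; abel
  have hle : Submodule.span K {a, b, c} ≤ K ∙ a := by
    have ha := Submodule.mem_span_singleton_self (R := K) a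
    have hc' : c ∈ K ∙ a := hc ▸ Submodule.smul_mem _ _ ha
    rw [Submodule.span_le, Set.insert_subset_iff, Set.insert_subset_iff, Set.singleton_subset_iff]
    exact ⟨ha, hb ▸ sub_mem (neg_mem ha) hc', hc'⟩
  exact (Submodule.finrank_mono hle).trans ((finrank_span_le_card _).trans (by simp))

theorem finrank_dualPart_add_two_le_one (hΓ : IsDistanceRegularWith Γ D p)
    (hbip : Γ.IsBipartite) (hv : dualIdem Γ x 2 *ᵥ v = v) (hsum : ∑ z, v z = 0) {e : ℕ → ℂ}
    (he : ofDist Γ e *ᵥ v = 0)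
    (hne : ∀ m, m + 4 ≤ D → ¬(e m = e (m + 2) ∧ e (m + 2) = e (m + 4))) (m : ℕ) :
    Module.finrank ℂ (dualPart Γ x (m + 2) (boseMesnerOrbit Γ v)) ≤ 1 := by
  set E := dualIdem Γ x (m + 2)
  have hpieces := dualIdem_mulVec_distMatrix_mulVec_add_eq_zero hΓ.connected hbip hv hsum m
  have hle : dualPart Γ x (m + 2) (boseMesnerOrbit Γ v) ≤ Submodule.span ℂ
      {E *ᵥ distMatrix Γ m *ᵥ v, E *ᵥ distMatrix Γ (m + 2) *ᵥ v,
        E *ᵥ distMatrix Γ (m + 4) *ᵥ v} := by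
    rintro _ ⟨_, ⟨B, hB, rfl⟩, rfl⟩
    obtain ⟨u, rfl⟩ := hΓ.exists_eq_ofDist_of_mem_boseMesner hB
    rw [Matrix.mulVecLin_apply, dualIdem_mulVec_ofDist_mulVec hΓ.connected hbip hv,
      Submodule.mem_span_triple]
    exact ⟨_, _, _, rfl⟩
  refine (Submodule.finrank_mono hle).trans ?_
  rcases le_or_gt (m + 4) D with hm | hm
  · refine finrank_span_triple_le_one hpieces ?_ (hne m hm)
    rw [← dualIdem_mulVec_ofDist_mulVec hΓ.connected hbip hv, he, Matrix.mulVec_zero]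
  · refine finrank_span_triple_le_one (α := 0) (β := 0) (γ := 1) hpieces ?_ (by simp)
    rw [hΓ.distMatrix_eq_zero_of_lt hm, Matrix.zero_mulVec, Matrix.mulVec_zero]
    simp

theorem dualPart_two_boseMesnerOrbit (hΓ : IsDistanceRegularWith Γ D p) (hbip : Γ.IsBipartite)
    (hv : dualIdem Γ x 2 *ᵥ v = v) (hsum : ∑ z, v z = 0) {η : ℂ}
    (hη : localMatrix Γ x *ᵥ v = η • v) : dualPart Γ x 2 (boseMesnerOrbit Γ v) = ℂ ∙ v := by
  refine le_antisymm ?_ ?_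
  · rintro _ ⟨_, ⟨B, hB, rfl⟩, rfl⟩
    obtain ⟨u, rfl⟩ := hΓ.exists_eq_ofDist_of_mem_boseMesner hB
    exact Submodule.mem_span_singleton.mpr
      ⟨_, (dualIdem_two_mulVec_ofDist_mulVec hΓ.connected hbip hv hsum hη u).symm⟩
  · rw [Submodule.span_singleton_le_iff_mem]
    exact ⟨v, self_mem_boseMesnerOrbit, hv⟩

theorem finrank_dualPart_boseMesnerOrbit_le_one (hΓ : IsDistanceRegularWith Γ D p)
    (hbip : Γ.IsBipartite) (hreg : Γ.IsRegularOfDegree k) (hD : 4 ≤ D) {θ : ℝ}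
    (hθ : θ ∈ eigenvalueFinset Γ) (hθ_ne : θ ≠ 0) (hθk : θ ^ 2 ≠ (k : ℝ) ^ 2)
    (hθb : θ ^ 2 ≠ bNum p 2) (hv : v ∈ spaceUEta Γ x (tilde p θ)) (i : ℕ) :
    Module.finrank ℂ (dualPart Γ x i (boseMesnerOrbit Γ v)) ≤ 1 := by
  have hsum := sum_eq_zero_of_mem_spaceU hΓ hbip hreg (by omega) hv.1
  have hsupp := dualIdem_two_mulVec_of_mem_spaceU hv.1
  obtain ⟨e, he, hE⟩ := hΓ.exists_isCosineSeq hbip hθ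
  have hstar : IsStarProjection (ofDist Γ e) := hE ▸ isStarProjection_primitiveIdempotent θ
  have hker : ofDist Γ e *ᵥ v = 0 := ofDist_mulVec_eq_zero hΓ.connected hbip hsupp hsum
    (Module.End.mem_eigenspace_iff.mp hv.2) hstar (he.tilde_relation hΓ hbip hreg hD hθb)
  match i with
  | 0 | 1 =>
    rw [dualPart_boseMesnerOrbit_eq_bot (by rw [hΓ.diam_eq]; omega) hv.1 (by omega), finrank_bot]
    exact zero_le_one
  | m + 2 =>
    exact finrank_dualPart_add_two_le_one hΓ hbip hsupp hsum hker (fun m hm =>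
      he.not_eq_and_eq hΓ hbip hreg (by exact_mod_cast hθ_ne) (by exact_mod_cast hθk) hm) m

end SecondSubconstituent

end DRG

end

theorem mainTheorem5 {X : Type*} [Fintype X] [DecidableEq X]
    (Γ : SimpleGraph X) [DecidableRel Γ.Adj]
    (D k : ℕ) (p : ℕ → ℕ → ℕ → ℕ)
    (hΓ : DRG.IsDistanceRegularWith Γ D p) (hbip : Γ.IsBipartite)
    (hD : 4 ≤ D) (hreg : Γ.IsRegularOfDegree k) (hk : 3 ≤ k)
    (x : X) (n : ℕ) (hn : n = 1 ∨ (Odd D ∧ n = D / 2)) :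
    DRG.eigenvalue Γ n ^ 2 ≠ (DRG.bNum p 2 : ℝ) ∧
    ∀ η : ℝ, η = DRG.tilde p (DRG.eigenvalue Γ n) →
      ∀ v ∈ DRG.spaceUEta Γ x η, v ≠ 0 →
        DRG.IsIrreducibleTModule Γ x (DRG.boseMesnerOrbit Γ v) ∧
        DRG.IsThin Γ x (DRG.boseMesnerOrbit Γ v) ∧
        DRG.HasEndpoint Γ x (DRG.boseMesnerOrbit Γ v) 2 ∧
        DRG.HasLocalEigenvalue Γ x (DRG.boseMesnerOrbit Γ v) η := by
  open DRG in
  have hθb : eigenvalue Γ n ^ 2 ≠ (bNum p 2 : ℝ) := by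
    rcases hn with rfl | ⟨hodd, rfl⟩
    exacts [(hΓ.bNum_two_lt_eigenvalue_one_sq hbip hreg hD).ne',
      (hΓ.eigenvalue_half_sq_lt_bNum_two hbip hreg hD hodd).ne]
  have hn_pos : 0 < n := by omega
  have hnD : 2 * n < D := by rcases hn with rfl | ⟨hodd, rfl⟩ <;> grind
  refine ⟨hθb, ?_⟩
  rintro η rfl v hv hv_ne
  have hη := Module.End.mem_eigenspace_iff.mp hv.2
  have hsum := sum_eq_zero_of_mem_spaceU hΓ hbip hreg (by omega) hv.1
  have hsupp := dualIdem_two_mulVec_of_mem_spaceU hv.1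
  have htwo := dualPart_two_boseMesnerOrbit hΓ hbip hsupp hsum hη
  have hlow {i : ℕ} (hi : i < 2) : dualPart Γ x i (boseMesnerOrbit Γ v) = ⊥ :=
    dualPart_boseMesnerOrbit_eq_bot (hΓ.diam_eq ▸ by omega) hv.1 hi
  have hthin := finrank_dualPart_boseMesnerOrbit_le_one hΓ hbip hreg hD
    (eigenvalue_mem (hΓ.lt_card_eigenvalueFinset (by omega))) (hΓ.eigenvalue_pos hbip hnD).ne'
    (hΓ.eigenvalue_sq_lt_degree_sq hbip hreg hn_pos hnD).ne hθb hv
  have hT := isTModule_boseMesnerOrbit hΓ.connected hbip hsupp (hlow one_lt_two) hthin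
  exact ⟨isIrreducibleTModule_boseMesnerOrbit hv_ne htwo hT, fun i _ => hthin i,
    hasEndpoint_of_dualPart_eq_span (by rw [hΓ.diam_eq]; omega) hv_ne htwo fun i hi => hlow hi,
    hasLocalEigenvalue_of_dualPart_eq_span hv_ne htwo hη⟩
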